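/- All matrices have nonnegative real entries. For $A\in\mathbb{R}_+^{m\times n}$ let $A\oplus B$ denote the direct sum (block diagonal matrix), $A\otimes B$ the Kronecker product and $\mathrm{I}_r$ the $r\times r$ identity matrix. Write $A\leqslant B$ if $A=XBY^{\top}$ for some nonnegative matrices $X,Y$. The nonnegative rank $\operatorname{rank}_+(A)$ is the least $r\in\mathbb{N}$ such that $A=BC$ with nonnegative $B\in\mathbb{R}_+^{m\times r}$, $C\in\mathbb{R}_+^{r\times n}$, and the nonnegative subrank $\operatorname{subrank}_+(A)$ is the largest $q\in\mathbb{N}$ such that $\mathrm{I}_q\leqslant A$. The asymptotic nonnegative rank and subrank are $$\widetilde{\operatorname{rank}}_+(A)=\lim_{k\to\infty}\operatorname{rank}_+(A^{\otimes k})^{1/k},\qquad \widetilde{\operatorname{subrank}}_+(A)=\lim_{k\to\infty}\operatorname{subrank}_+(A^{\otimes k})^{1/k}.$$ Let $\mathrm{GL}^+(n)$ be the group of invertible nonnegative $n\times n$ matrices whose inverse is nonnegative. For $A,B$ of the same size $m\times n$ write $A\cong B$ if $A=XBY^{\top}$ with $X\in\mathrm{GL}^+(m)$, $Y\in\mathrm{GL}^+(n)$;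 for $A,B$ of arbitrary sizes write $A\sim B$ if $A\oplus A_0\cong B\oplus B_0$ for some zero matrices $A_0,B_0$. The set $\mathbb{M}_+$ of $\sim$-equivalence classes $[A]$ of nonnegative matrices is a commutative semiring under $[A]+[B]=[A\oplus B]$ and $[A]\cdot[B]=[A\otimes B]$, with zero the class of the zero matrices and one the class of $\mathrm{I}_1$, and $\leqslant$ induces a preorder on it. The asymptotic spectrum of nonnegative matrices $\mathbf{X}(\mathbb{M}_+,\leqslant)$ is the set of all semiring homomorphisms $\phi:\mathbb{M}_+\to\mathbb{R}_{\ge 0}$ such that $a\leqslant b$ implies $\phi(a)\le\phi(b)$; write $\phi(A)$ for $\phi([A])$. **Theorem.** For every nonnegative matrix $A$ the two limits above exist, and $$\widetilde{\operatorname{rank}}_+(A)=\max_{\phi\in\mathbf{X}(\mathbb{M}_+,\leqslant)}\phi(A),\qquad \widetilde{\operatorname{subrank}}_+(A)=\min_{\phi\in\mathbf{X}(\mathbb{M}_+,\leqslant)}\phi(A),$$ the maximum and the minimum being attained. -/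

import Mathlib

open scoped NNReal Matrix Kronecker Topology

noncomputable section

namespace NonnegMatrix

/-! ### Auxiliary relations for rectangular matrices over arbitrary finite index types -/

section Aux

variable {m n p q m' n' p' q' a b c d : Type}
variable [Fintype m] [Fintype n] [Fintype p] [Fintype q] [Fintype m'] [Fintype n'] [Fintype p']
  [Fintype q'] [Fintype a] [Fintype b] [Fintype c] [Fintype d]
variable [DecidableEq m] [DecidableEq n] [DecidableEq p] [DecidableEq q] [DecidableEq m']
  [DecidableEq n'] [DecidableEq p'] [DecidableEq q'] [DecidableEq a] [DecidableEq b]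
  [DecidableEq c] [DecidableEq d]

/-- `A ⊕ B`, the block diagonal matrix. -/
abbrev blockSum (A : Matrix m n ℝ≥0) (B : Matrix p q ℝ≥0) : Matrix (m ⊕ p) (n ⊕ q) ℝ≥0 :=
  Matrix.fromBlocks A 0 0 B

/-- `A = X B Yᵀ` with `X`, `Y` nonnegative and having nonnegative two-sided inverses `X'`, `Y'`;
the index types of `A` and `B` need not be the same. -/
def RIso (A : Matrix m n ℝ≥0) (B : Matrix p q ℝ≥0) : Prop :=
  ∃ (X : Matrix m p ℝ≥0) (X' : Matrix p m ℝ≥0) (Y : Matrix n q ℝ≥0) (Y' : Matrix q n ℝ≥0),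
    X * X' = 1 ∧ X' * X = 1 ∧ Y * Y' = 1 ∧ Y' * Y = 1 ∧ A = X * B * Yᵀ

theorem RIso.of_equiv {A : Matrix m n ℝ≥0} {B : Matrix p q ℝ≥0} (e : m ≃ p) (f : n ≃ q)
    (h : ∀ i j, A i j = B (e i) (f j)) : RIso A B := by
  refine ⟨(1 : Matrix p p ℝ≥0).submatrix e id, (1 : Matrix p p ℝ≥0).submatrix id e,
    (1 : Matrix q q ℝ≥0).submatrix f id, (1 : Matrix q q ℝ≥0).submatrix id f, ?_, ?_, ?_, ?_, ?_⟩
  · rw [← Matrix.submatrix_mul _ _ e id e Function.bijective_id]; simp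
  · rw [Matrix.submatrix_mul_equiv]; simp
  · rw [← Matrix.submatrix_mul _ _ f id f Function.bijective_id]; simp
  · rw [Matrix.submatrix_mul_equiv]; simp
  · ext i j
    simp [Matrix.mul_apply, Matrix.one_apply, h]

theorem RIso.refl (A : Matrix m n ℝ≥0) : RIso A A :=
  RIso.of_equiv (Equiv.refl _) (Equiv.refl _) fun _ _ => rfl

theorem RIso.symm {A : Matrix m n ℝ≥0} {B : Matrix p q ℝ≥0} (h : RIso A B) : RIso B A := by
  obtain ⟨X, X', Y, Y', h1, h2, h3, h4, rfl⟩ := h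
  refine ⟨X', X, Y', Y, h2, h1, h4, h3, ?_⟩
  have h5 : Yᵀ * Y'ᵀ = 1 := by rw [← Matrix.transpose_mul, h4, Matrix.transpose_one]
  calc B = (X' * X) * B * (Yᵀ * Y'ᵀ) := by rw [h2, h5]; simp
    _ = X' * (X * B * Yᵀ) * Y'ᵀ := by simp only [Matrix.mul_assoc]

theorem RIso.trans {A : Matrix m n ℝ≥0} {B : Matrix p q ℝ≥0} {C : Matrix m' n' ℝ≥0}
    (h : RIso A B) (h' : RIso B C) : RIso A C := by
  obtain ⟨X, X', Y, Y', h1, h2, h3, h4, rfl⟩ := h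
  obtain ⟨U, U', V, V', k1, k2, k3, k4, rfl⟩ := h'
  refine ⟨X * U, U' * X', Y * V, V' * Y', ?_, ?_, ?_, ?_, ?_⟩
  · rw [Matrix.mul_assoc, ← Matrix.mul_assoc U, k1, Matrix.one_mul, h1]
  · rw [Matrix.mul_assoc, ← Matrix.mul_assoc X', h2, Matrix.one_mul, k2]
  · rw [Matrix.mul_assoc, ← Matrix.mul_assoc V, k3, Matrix.one_mul, h3]
  · rw [Matrix.mul_assoc, ← Matrix.mul_assoc Y', h4, Matrix.one_mul, k4]
  · simp only [Matrix.mul_assoc, Matrix.transpose_mul]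

theorem RIso.sum {A : Matrix m n ℝ≥0} {B : Matrix p q ℝ≥0} {C : Matrix m' n' ℝ≥0}
    {D : Matrix p' q' ℝ≥0} (h : RIso A B) (h' : RIso C D) :
    RIso (blockSum A C) (blockSum B D) := by
  obtain ⟨X, X', Y, Y', h1, h2, h3, h4, rfl⟩ := h
  obtain ⟨U, U', V, V', k1, k2, k3, k4, rfl⟩ := h'
  refine ⟨blockSum X U, blockSum X' U', blockSum Y V, blockSum Y' V', ?_, ?_, ?_, ?_, ?_⟩ <;>
    simp [blockSum, Matrix.fromBlocks_multiply, Matrix.fromBlocks_transpose, *]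

theorem RIso.kron {A : Matrix m n ℝ≥0} {B : Matrix p q ℝ≥0} {C : Matrix m' n' ℝ≥0}
    {D : Matrix p' q' ℝ≥0} (h : RIso A B) (h' : RIso C D) : RIso (A ⊗ₖ C) (B ⊗ₖ D) := by
  obtain ⟨X, X', Y, Y', h1, h2, h3, h4, rfl⟩ := h
  obtain ⟨U, U', V, V', k1, k2, k3, k4, rfl⟩ := h'
  refine ⟨X ⊗ₖ U, X' ⊗ₖ U', Y ⊗ₖ V, Y' ⊗ₖ V', ?_, ?_, ?_, ?_, ?_⟩
  · rw [← Matrix.mul_kronecker_mul, h1, k1, Matrix.one_kronecker_one]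
  · rw [← Matrix.mul_kronecker_mul, h2, k2, Matrix.one_kronecker_one]
  · rw [← Matrix.mul_kronecker_mul, h3, k3, Matrix.one_kronecker_one]
  · rw [← Matrix.mul_kronecker_mul, h4, k4, Matrix.one_kronecker_one]
  · rw [Matrix.mul_kronecker_mul, Matrix.mul_kronecker_mul, Matrix.kroneckerMap_transpose]

/-- `RIso` after adding zero blocks to both matrices. -/
def RSim (A : Matrix m n ℝ≥0) (B : Matrix p q ℝ≥0) : Prop :=
  ∃ a₁ a₂ b₁ b₂ : ℕ, RIso (blockSum A (0 : Matrix (Fin a₁) (Fin a₂) ℝ≥0))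
    (blockSum B (0 : Matrix (Fin b₁) (Fin b₂) ℝ≥0))

theorem RIso.zero_equiv (e : a ≃ c) (f : b ≃ d) :
    RIso (0 : Matrix a b ℝ≥0) (0 : Matrix c d ℝ≥0) :=
  RIso.of_equiv e f fun _ _ => rfl

theorem RSim.of_pads {A : Matrix m n ℝ≥0} {B : Matrix p q ℝ≥0}
    (h : RIso (blockSum A (0 : Matrix a b ℝ≥0)) (blockSum B (0 : Matrix c d ℝ≥0))) :
    RSim A B :=
  ⟨Fintype.card a, Fintype.card b, Fintype.card c, Fintype.card d,
    ((RIso.refl A).sum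
      (RIso.zero_equiv (Fintype.equivFin a).symm (Fintype.equivFin b).symm)).trans
      (h.trans ((RIso.refl B).sum (RIso.zero_equiv (Fintype.equivFin c) (Fintype.equivFin d))))⟩

theorem RIso.rsim {A : Matrix m n ℝ≥0} {B : Matrix p q ℝ≥0} (h : RIso A B) : RSim A B :=
  ⟨0, 0, 0, 0, h.sum (RIso.refl _)⟩

theorem RSim.symm {A : Matrix m n ℝ≥0} {B : Matrix p q ℝ≥0} (h : RSim A B) : RSim B A := by
  obtain ⟨a₁, a₂, b₁, b₂, h⟩ := h
  exact ⟨b₁, b₂, a₁, a₂, h.symm⟩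

theorem RIso.sum_assoc (A : Matrix m n ℝ≥0) (B : Matrix p q ℝ≥0) (C : Matrix m' n' ℝ≥0) :
    RIso (blockSum (blockSum A B) C) (blockSum A (blockSum B C)) :=
  RIso.of_equiv (Equiv.sumAssoc _ _ _) (Equiv.sumAssoc _ _ _) <| by
    rintro ((i | i) | i) ((j | j) | j) <;> rfl

theorem RIso.sum_comm (A : Matrix m n ℝ≥0) (B : Matrix p q ℝ≥0) :
    RIso (blockSum A B) (blockSum B A) :=
  RIso.of_equiv (Equiv.sumComm _ _) (Equiv.sumComm _ _) <| by
    rintro (i | i) (j | j) <;> rfl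

theorem blockSum_zero_zero {a b c d : Type} :
    blockSum (0 : Matrix a b ℝ≥0) (0 : Matrix c d ℝ≥0) = 0 :=
  Matrix.fromBlocks_zero

theorem RSim.trans {A : Matrix m n ℝ≥0} {B : Matrix p q ℝ≥0} {C : Matrix m' n' ℝ≥0}
    (h : RSim A B) (h' : RSim B C) : RSim A C := by
  obtain ⟨a₁, a₂, b₁, b₂, h⟩ := h
  obtain ⟨c₁, c₂, d₁, d₂, h'⟩ := h'
  have k := (RIso.sum_assoc _ _ _).symm.trans
    (h.sum (RIso.refl (0 : Matrix (Fin c₁) (Fin c₂) ℝ≥0)))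
  have k' := (h'.sum (RIso.refl (0 : Matrix (Fin b₁) (Fin b₂) ℝ≥0))).trans (RIso.sum_assoc _ _ _)
  have l : RIso
      (blockSum (blockSum B (0 : Matrix (Fin b₁) (Fin b₂) ℝ≥0)) (0 : Matrix (Fin c₁) (Fin c₂) ℝ≥0))
      (blockSum (blockSum B (0 : Matrix (Fin c₁) (Fin c₂) ℝ≥0))
        (0 : Matrix (Fin b₁) (Fin b₂) ℝ≥0)) :=
    (RIso.sum_assoc _ _ _).trans
      (((RIso.refl B).sum (RIso.sum_comm _ _)).trans (RIso.sum_assoc _ _ _).symm)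
  have r := k.trans (l.trans k')
  rw [blockSum_zero_zero, blockSum_zero_zero] at r
  exact RSim.of_pads r

theorem RIso.sum_swap (A : Matrix m n ℝ≥0) (B : Matrix p q ℝ≥0) (C : Matrix m' n' ℝ≥0)
    (D : Matrix p' q' ℝ≥0) :
    RIso (blockSum (blockSum A B) (blockSum C D)) (blockSum (blockSum A C) (blockSum B D)) :=
  RIso.of_equiv (Equiv.sumSumSumComm _ _ _ _) (Equiv.sumSumSumComm _ _ _ _) <| by
    rintro ((i | i) | (i | i)) ((j | j) | (j | j)) <;> rfl

theorem RSim.sum {A : Matrix m n ℝ≥0} {B : Matrix p q ℝ≥0} {C : Matrix m' n' ℝ≥0}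
    {D : Matrix p' q' ℝ≥0} (h : RSim A B) (h' : RSim C D) :
    RSim (blockSum A C) (blockSum B D) := by
  obtain ⟨a₁, a₂, b₁, b₂, h⟩ := h
  obtain ⟨c₁, c₂, d₁, d₂, h'⟩ := h'
  have r := (RIso.sum_swap _ _ _ _).trans ((h.sum h').trans (RIso.sum_swap _ _ _ _))
  rw [blockSum_zero_zero, blockSum_zero_zero] at r
  exact RSim.of_pads r

theorem RIso.kron_pad (A : Matrix m n ℝ≥0) (B : Matrix p q ℝ≥0) :
    RIso (blockSum A (0 : Matrix a b ℝ≥0) ⊗ₖ blockSum B (0 : Matrix c d ℝ≥0))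
      (blockSum (A ⊗ₖ B) (0 : Matrix (m × c ⊕ a × (p ⊕ c)) (n × d ⊕ b × (q ⊕ d)) ℝ≥0)) := by
  refine RIso.of_equiv
    ((Equiv.sumProdDistrib _ _ _).trans
      (((Equiv.prodSumDistrib _ _ _).sumCongr (Equiv.refl _)).trans (Equiv.sumAssoc _ _ _)))
    ((Equiv.sumProdDistrib _ _ _).trans
      (((Equiv.prodSumDistrib _ _ _).sumCongr (Equiv.refl _)).trans (Equiv.sumAssoc _ _ _))) ?_
  rintro ⟨i | i, i' | i'⟩ ⟨j | j, j' | j'⟩ <;> simp [blockSum]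

theorem RSim.kron {A : Matrix m n ℝ≥0} {B : Matrix p q ℝ≥0} {C : Matrix m' n' ℝ≥0}
    {D : Matrix p' q' ℝ≥0} (h : RSim A B) (h' : RSim C D) : RSim (A ⊗ₖ C) (B ⊗ₖ D) := by
  obtain ⟨a₁, a₂, b₁, b₂, h⟩ := h
  obtain ⟨c₁, c₂, d₁, d₂, h'⟩ := h'
  exact RSim.of_pads ((RIso.kron_pad _ _).symm.trans ((h.kron h').trans (RIso.kron_pad _ _)))

theorem RSim.zero : RSim (0 : Matrix m n ℝ≥0) (0 : Matrix p q ℝ≥0) := by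
  have r := RIso.sum_comm (0 : Matrix m n ℝ≥0) (0 : Matrix p q ℝ≥0)
  exact RSim.of_pads r

end Aux

/-! ### Nonnegative matrices -/

/-- A nonnegative matrix of some size `rows × cols`. -/
structure NNMat : Type where
  rows : ℕ
  cols : ℕ
  mat : Matrix (Fin rows) (Fin cols) ℝ≥0

namespace NNMat

/-- The identity matrix `I_n`. -/
def idMat (n : ℕ) : NNMat := ⟨n, n, 1⟩

/-- The zero matrix of size `a × b`. -/
def zeroMat (a b : ℕ) : NNMat := ⟨a, b, 0⟩

/-- The direct sum `A ⊕ B = [A 0; 0 B]`. -/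
def directSum (A B : NNMat) : NNMat :=
  ⟨A.rows + B.rows, A.cols + B.cols,
    Matrix.reindex finSumFinEquiv finSumFinEquiv (Matrix.fromBlocks A.mat 0 0 B.mat)⟩

/-- The Kronecker product `A ⊗ B`, whose `(i, j)` block is `A i j • B`. -/
def kron (A B : NNMat) : NNMat :=
  ⟨A.rows * B.rows, A.cols * B.cols,
    Matrix.reindex finProdFinEquiv finProdFinEquiv (A.mat ⊗ₖ B.mat)⟩

/-- The Kronecker power `A^{⊗ k}`. -/
def kronPow (A : NNMat) : ℕ → NNMat
  | 0 => idMat 1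
  | k + 1 => kron (kronPow A k) A

/-- `A ≅ B`: the two matrices have the same size `m × n`, and `A = X B Yᵀ` for some
`X ∈ GL⁺(m)`, `Y ∈ GL⁺(n)`. Here `GL⁺(m)`, the group of nonnegative matrices with a nonnegative
inverse, is the unit group of the semiring of `m × m` matrices over `ℝ≥0`. -/
def Cong (A B : NNMat) : Prop :=
  ∃ (m n : ℕ) (M N : Matrix (Fin m) (Fin n) ℝ≥0),
    A = ⟨m, n, M⟩ ∧ B = ⟨m, n, N⟩ ∧
      ∃ (X : (Matrix (Fin m) (Fin m) ℝ≥0)ˣ) (Y : (Matrix (Fin n) (Fin n) ℝ≥0)ˣ),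
        M = X.val * N * (Y.val)ᵀ

/-- `A ∼ B`: `A ⊕ A₀ ≅ B ⊕ B₀` for some zero matrices `A₀` and `B₀`. -/
def Sim (A B : NNMat) : Prop :=
  ∃ a₁ a₂ b₁ b₂ : ℕ, Cong (directSum A (zeroMat a₁ a₂)) (directSum B (zeroMat b₁ b₂))

/-- `A ≤ B`: `A = X B Yᵀ` for some nonnegative matrices `X` and `Y`. -/
def Below (A B : NNMat) : Prop :=
  ∃ (X : Matrix (Fin A.rows) (Fin B.rows) ℝ≥0) (Y : Matrix (Fin A.cols) (Fin B.cols) ℝ≥0),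
    A.mat = X * B.mat * Yᵀ

theorem card_eq_of_inverse {m p : ℕ} {X : Matrix (Fin m) (Fin p) ℝ≥0}
    {X' : Matrix (Fin p) (Fin m) ℝ≥0} (h : X * X' = 1) (h' : X' * X = 1) : m = p := by
  have k : X.map NNReal.toRealHom * X'.map NNReal.toRealHom = 1 := by
    rw [← Matrix.map_mul, h, Matrix.map_one _ (map_zero _) (map_one _)]
  have k' : X'.map NNReal.toRealHom * X.map NNReal.toRealHom = 1 := by
    rw [← Matrix.map_mul, h', Matrix.map_one _ (map_zero _) (map_one _)]
  simpa using Matrix.square_of_invertible _ _ k k'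

theorem cong_iff (A B : NNMat) : Cong A B ↔ RIso A.mat B.mat := by
  constructor
  · rintro ⟨m, n, M, N, rfl, rfl, X, Y, rfl⟩
    exact ⟨X.val, X.inv, Y.val, Y.inv, X.val_inv, X.inv_val, Y.val_inv, Y.inv_val, rfl⟩
  · obtain ⟨m, n, M⟩ := A
    obtain ⟨p, q, N⟩ := B
    rintro ⟨X, X', Y, Y', h1, h2, h3, h4, h⟩
    obtain rfl : m = p := card_eq_of_inverse h1 h2
    obtain rfl : n = q := card_eq_of_inverse h3 h4
    exact ⟨m, n, M, N, rfl, rfl, ⟨X, X', h1, h2⟩, ⟨Y, Y', h3, h4⟩, h⟩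

theorem directSum_riso (A B : NNMat) : RIso (directSum A B).mat (blockSum A.mat B.mat) :=
  RIso.of_equiv finSumFinEquiv.symm finSumFinEquiv.symm fun _ _ => rfl

theorem kron_riso (A B : NNMat) : RIso (kron A B).mat (A.mat ⊗ₖ B.mat) :=
  RIso.of_equiv finProdFinEquiv.symm finProdFinEquiv.symm fun _ _ => rfl

theorem sim_iff (A B : NNMat) : Sim A B ↔ RSim A.mat B.mat := by
  constructor
  · rintro ⟨a₁, a₂, b₁, b₂, h⟩
    exact ⟨a₁, a₂, b₁, b₂,
      (directSum_riso A (zeroMat a₁ a₂)).symm.trans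
        (((cong_iff _ _).1 h).trans (directSum_riso B (zeroMat b₁ b₂)))⟩
  · rintro ⟨a₁, a₂, b₁, b₂, h⟩
    exact ⟨a₁, a₂, b₁, b₂, (cong_iff _ _).2
      ((directSum_riso A (zeroMat a₁ a₂)).trans
        (h.trans (directSum_riso B (zeroMat b₁ b₂)).symm))⟩

/-- The relation `∼` is an equivalence relation. -/
instance simSetoid : Setoid NNMat where
  r := Sim
  iseqv :=
    { refl := fun A => (sim_iff A A).2 (RIso.refl _).rsim
      symm := fun h => (sim_iff _ _).2 ((sim_iff _ _).1 h).symm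
      trans := fun h h' => (sim_iff _ _).2 (((sim_iff _ _).1 h).trans ((sim_iff _ _).1 h')) }

theorem directSum_sim {A B A' B' : NNMat} (h : Sim A A') (h' : Sim B B') :
    Sim (directSum A B) (directSum A' B') :=
  (sim_iff _ _).2 ((directSum_riso A B).rsim.trans
    ((((sim_iff _ _).1 h).sum ((sim_iff _ _).1 h')).trans (directSum_riso A' B').symm.rsim))

theorem kron_sim {A B A' B' : NNMat} (h : Sim A A') (h' : Sim B B') :
    Sim (kron A B) (kron A' B') :=
  (sim_iff _ _).2 ((kron_riso A B).rsim.trans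
    ((((sim_iff _ _).1 h).kron ((sim_iff _ _).1 h')).trans (kron_riso A' B').symm.rsim))

theorem below_refl (A : NNMat) : Below A A := ⟨1, 1, by simp⟩

theorem below_trans {A B C : NNMat} (h : Below A B) (h' : Below B C) : Below A C := by
  obtain ⟨X, Y, h⟩ := h
  obtain ⟨U, V, h'⟩ := h'
  exact ⟨X * U, Y * V, by rw [h, h']; simp only [Matrix.mul_assoc, Matrix.transpose_mul]⟩

theorem Sim.below {A B : NNMat} (h : Sim A B) : Below A B := by
  obtain ⟨a₁, a₂, b₁, b₂, X, -, Y, -, -, -, -, -, h⟩ := (sim_iff _ _).1 h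
  refine ⟨X.toBlocks₁₁, Y.toBlocks₁₁, ?_⟩
  rw [← Matrix.fromBlocks_toBlocks X, ← Matrix.fromBlocks_toBlocks Y] at h
  simp only [blockSum, Matrix.fromBlocks_transpose, Matrix.fromBlocks_multiply] at h
  simpa using congrArg Matrix.toBlocks₁₁ h

/-- The nonnegative rank: the least `r` such that `A = B C` with nonnegative matrices `B` and `C`
with inner dimension `r`. -/
def nonnegRank (A : NNMat) : ℕ :=
  sInf {r : ℕ | ∃ (B : Matrix (Fin A.rows) (Fin r) ℝ≥0) (C : Matrix (Fin r) (Fin A.cols) ℝ≥0),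
    A.mat = B * C}

/-- The nonnegative subrank: the largest `q` such that `I_q ≤ A`. -/
def nonnegSubrank (A : NNMat) : ℕ :=
  sSup {q : ℕ | Below (idMat q) A}

/-- The set whose minimum is the nonnegative rank is nonempty. -/
theorem nonnegRank_set_nonempty (A : NNMat) :
    {r : ℕ | ∃ (B : Matrix (Fin A.rows) (Fin r) ℝ≥0) (C : Matrix (Fin r) (Fin A.cols) ℝ≥0),
      A.mat = B * C}.Nonempty :=
  ⟨A.rows, 1, A.mat, by simp⟩

/-- The set whose maximum is the nonnegative subrank is nonempty and bounded. -/
theorem nonnegSubrank_set_bdd (A : NNMat) :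
    {q : ℕ | Below (idMat q) A}.Nonempty ∧ BddAbove {q : ℕ | Below (idMat q) A} := by
  refine ⟨⟨0, 0, 0, ?_⟩, A.rows, ?_⟩
  · ext i
    exact i.elim0
  · rintro q ⟨X, Y, h⟩
    have h1 : (1 : Matrix (Fin q) (Fin q) ℝ≥0) = X * (A.mat * Yᵀ) := by
      rw [← Matrix.mul_assoc]; exact h
    have h2 : (1 : Matrix (Fin q) (Fin q) ℝ) =
        X.map NNReal.toRealHom * (A.mat * Yᵀ).map NNReal.toRealHom := by
      rw [← Matrix.map_mul, ← h1]
      exact (Matrix.map_one _ (map_zero _) (map_one _)).symm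
    calc q = (1 : Matrix (Fin q) (Fin q) ℝ).rank := by simp
      _ ≤ (X.map NNReal.toRealHom).rank := by rw [h2]; exact Matrix.rank_mul_le_left _ _
      _ ≤ A.rows := Matrix.rank_le_width _

/-- The asymptotic nonnegative rank `lim_k nonnegRank (A^{⊗ k})^{1/k}`. -/
def asympNonnegRank (A : NNMat) : ℝ :=
  Filter.limUnder Filter.atTop fun k : ℕ => ((kronPow A k).nonnegRank : ℝ) ^ (1 / (k : ℝ))

/-- The asymptotic nonnegative subrank `lim_k nonnegSubrank (A^{⊗ k})^{1/k}`. -/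
def asympNonnegSubrank (A : NNMat) : ℝ :=
  Filter.limUnder Filter.atTop fun k : ℕ => ((kronPow A k).nonnegSubrank : ℝ) ^ (1 / (k : ℝ))

end NNMat

/-! ### The semiring of classes of nonnegative matrices -/

/-- The set `𝕄₊` of `∼`-classes of nonnegative matrices. -/
def NNMatClass : Type := Quotient NNMat.simSetoid

namespace NNMatClass

open NNMat

/-- The class `[A]` of a nonnegative matrix. -/
def mk (A : NNMat) : NNMatClass := Quotient.mk NNMat.simSetoid A

theorem mk_eq_of_rsim {A B : NNMat} (h : RSim A.mat B.mat) : mk A = mk B :=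
  Quotient.sound ((sim_iff A B).2 h)

/-- `[A] + [B] = [A ⊕ B]`. -/
instance : Add NNMatClass where
  add := Quotient.map₂ directSum fun _ _ h _ _ h' => directSum_sim h h'

/-- `[A] * [B] = [A ⊗ B]`. -/
instance : Mul NNMatClass where
  mul := Quotient.map₂ kron fun _ _ h _ _ h' => kron_sim h h'

instance : Zero NNMatClass where
  zero := mk (zeroMat 0 0)

instance : One NNMatClass where
  one := mk (idMat 1)

theorem mk_add (A B : NNMat) : mk A + mk B = mk (directSum A B) := rfl

theorem mk_mul (A B : NNMat) : mk A * mk B = mk (kron A B) := rfl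

theorem zero_def : (0 : NNMatClass) = mk (zeroMat 0 0) := rfl

theorem one_def : (1 : NNMatClass) = mk (idMat 1) := rfl

theorem ind {P : NNMatClass → Prop} (h : ∀ A, P (mk A)) (x : NNMatClass) : P x :=
  Quotient.ind h x

protected theorem add_assoc (x y z : NNMatClass) : x + y + z = x + (y + z) := by
  induction x using ind with | h A
  induction y using ind with | h B
  induction z using ind with | h C
  simp only [mk_add]
  exact mk_eq_of_rsim (((directSum_riso _ _).trans
    (((directSum_riso _ _).sum (RIso.refl _)).trans ((RIso.sum_assoc _ _ _).trans
      ((((RIso.refl _).sum (directSum_riso _ _).symm)).trans (directSum_riso _ _).symm)))).rsim)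

protected theorem add_comm (x y : NNMatClass) : x + y = y + x := by
  induction x using ind with | h A
  induction y using ind with | h B
  simp only [mk_add]
  exact mk_eq_of_rsim ((directSum_riso _ _).trans
    ((RIso.sum_comm _ _).trans (directSum_riso _ _).symm)).rsim

protected theorem add_zero (x : NNMatClass) : x + 0 = x := by
  induction x using ind with | h A
  exact mk_eq_of_rsim ((directSum_riso _ _).trans
    (RIso.of_equiv (Equiv.sumEmpty (Fin A.rows) (Fin 0)) (Equiv.sumEmpty (Fin A.cols) (Fin 0)) (by
      rintro (i | i) (j | j)
      · rfl
      · exact j.elim0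
      · exact i.elim0
      · exact i.elim0))).rsim

protected theorem mul_comm (x y : NNMatClass) : x * y = y * x := by
  induction x using ind with | h A
  induction y using ind with | h B
  simp only [mk_mul]
  exact mk_eq_of_rsim ((kron_riso _ _).trans
    ((RIso.of_equiv (Equiv.prodComm _ _) (Equiv.prodComm _ _) fun _ _ => mul_comm _ _).trans
      (kron_riso _ _).symm)).rsim

protected theorem mul_assoc (x y z : NNMatClass) : x * y * z = x * (y * z) := by
  induction x using ind with | h A
  induction y using ind with | h B
  induction z using ind with | h C
  simp only [mk_mul]
  exact mk_eq_of_rsim (((kron_riso _ _).trans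
    (((kron_riso _ _).kron (RIso.refl _)).trans
      ((RIso.of_equiv (Equiv.prodAssoc _ _ _) (Equiv.prodAssoc _ _ _)
        fun _ _ => mul_assoc _ _ _).trans
      ((((RIso.refl _).kron (kron_riso _ _).symm)).trans (kron_riso _ _).symm)))).rsim)

protected theorem mul_one (x : NNMatClass) : x * 1 = x := by
  induction x using ind with | h A
  exact mk_eq_of_rsim ((kron_riso _ _).trans
    (RIso.of_equiv (Equiv.prodUnique (Fin A.rows) (Fin 1)) (Equiv.prodUnique (Fin A.cols) (Fin 1))
      (by
        rintro ⟨i, (i' : Fin 1)⟩ ⟨j, (j' : Fin 1)⟩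
        have h : (idMat 1).mat i' j' = 1 := by
          rw [Subsingleton.elim i' j']; exact Matrix.one_apply_eq j'
        exact (congrArg (A.mat i j * ·) h).trans (mul_one _)))).rsim

protected theorem mul_zero (x : NNMatClass) : x * 0 = 0 := by
  induction x using ind with | h A
  refine mk_eq_of_rsim ((kron_riso _ _).rsim.trans ?_)
  have h : A.mat ⊗ₖ (zeroMat 0 0).mat = 0 := Matrix.kronecker_zero _
  rw [h]
  exact RSim.zero

protected theorem add_mul (x y z : NNMatClass) : (x + y) * z = x * z + y * z := by
  induction x using ind with | h A
  induction y using ind with | h B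
  induction z using ind with | h C
  simp only [mk_mul, mk_add]
  exact mk_eq_of_rsim (((kron_riso _ _).trans
    (((directSum_riso _ _).kron (RIso.refl _)).trans
      ((RIso.of_equiv (B := blockSum (A.mat ⊗ₖ C.mat) (B.mat ⊗ₖ C.mat))
        (Equiv.sumProdDistrib _ _ _) (Equiv.sumProdDistrib _ _ _)
        (by rintro ⟨i | i, i'⟩ ⟨j | j, j'⟩ <;> simp [blockSum])).trans
      ((((kron_riso _ _).symm.sum (kron_riso _ _).symm)).trans (directSum_riso _ _).symm)))).rsim)

/-- The commutative semiring `𝕄₊`, with addition `⊕`, multiplication `⊗`, zero the class of the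
zero matrices and one the class of `I_1`. -/
instance : CommSemiring NNMatClass where
  add_assoc := NNMatClass.add_assoc
  zero_add x := by rw [NNMatClass.add_comm, NNMatClass.add_zero]
  add_zero := NNMatClass.add_zero
  add_comm := NNMatClass.add_comm
  nsmul := nsmulRec
  left_distrib x y z := by
    rw [NNMatClass.mul_comm, NNMatClass.add_mul, NNMatClass.mul_comm y, NNMatClass.mul_comm z]
  right_distrib := NNMatClass.add_mul
  zero_mul x := by rw [NNMatClass.mul_comm, NNMatClass.mul_zero]
  mul_zero := NNMatClass.mul_zero
  mul_assoc := NNMatClass.mul_assoc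
  one_mul x := by rw [NNMatClass.mul_comm, NNMatClass.mul_one]
  mul_one := NNMatClass.mul_one
  mul_comm := NNMatClass.mul_comm

/-- `[A] ≤ [B]` if and only if `A ≤ B`. -/
instance : LE NNMatClass where
  le := Quotient.lift₂ Below fun _ _ _ _ h h' => propext
    ⟨fun k => below_trans (Sim.below (Setoid.symm h)) (below_trans k (Sim.below h')),
      fun k => below_trans (Sim.below h) (below_trans k (Sim.below (Setoid.symm h')))⟩

theorem mk_le_mk (A B : NNMat) : mk A ≤ mk B ↔ Below A B := Iff.rfl

instance : Preorder NNMatClass where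
  le_refl := ind below_refl
  le_trans x y z := by
    induction x using ind with | h A
    induction y using ind with | h B
    induction z using ind with | h C
    exact below_trans

end NNMatClass

/-- The asymptotic spectrum of a commutative semiring with a preorder: the monotone semiring
homomorphisms to the nonnegative reals. -/
def asympSpectrum (S : Type) [CommSemiring S] [Preorder S] : Set (S →+* ℝ≥0) :=
  {φ | ∀ a b : S, a ≤ b → φ a ≤ φ b}

end NonnegMatrix

end

/-! The proof is Strassen's duality, applied to two preorders on the semiring of classes. For a
Strassen preorder `R`, Zorn's lemma extends `R` to a maximal one. A maximal preorder is total,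
because it absorbs its Archimedean closure, its cancellation closure and every inequality that can
be adjoined consistently. In a total preorder each element has a well-defined real size, the infimum
of `n / m` over `m * a ≤ n`, and this size is a spectral point. So the spectrum is nonempty.

If now `φ y < φ x` at every spectral point of `R`, then no Strassen preorder extends `R` by `x ≤ y`.
The resulting obstruction `n + 1 + s * y ≤ n + s * x` is turned by multiplication and iteration into
`y ^ (j * L) ≤ c * r ^ L * x ^ (j * L)` (`pow_le_of_forall_lt`), whose factors disappear after
taking roots. Fekete's lemma gives the limits, compactness gives extremal spectral points, and
comparing powers of `a` with integers identifies the two.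

For the rank the factors `c` and `r ^ L` are integers and enter the bound directly. For the subrank
they must be absorbed into powers of `a`, which needs `2 ≤ a ^ d`, or else `a ≤ 1`. The order `≤` on
matrices fails this: a positive matrix of rank above one is not below `I_1`, yet all its powers have
subrank one. The remedy is `SuppLE`, which sees only supports. It has the same integers below each
element, hence the same subrank, and it satisfies the dichotomy by `matSuppBelow_one_or_two_kron`.
Its spectral points are monotone for `≤` as well, so the minimum is attained inside the original
spectrum. -/

namespace NonnegMatrix

/-! ### Strassen preorders and their spectra -/

section Strassen

variable {S : Type} [CommSemiring S]

/-- A preorder on a commutative semiring that is compatible with the operations, restricts to the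
usual order on the natural numbers, and for which every element is bounded by a natural number
and every nonzero element is at least `1`. -/
structure IsStrassenPreorder (R : S → S → Prop) : Prop where
  refl : ∀ a, R a a
  trans : ∀ {a b c}, R a b → R b c → R a c
  add_right : ∀ {a b}, R a b → ∀ c, R (a + c) (b + c)
  mul_right : ∀ {a b}, R a b → ∀ c, R (a * c) (b * c)
  le_of_cast : ∀ {n m : ℕ}, R n m → n ≤ m
  zero_le : ∀ a, R 0 a
  bounded : ∀ a, ∃ n : ℕ, R a n
  one_le : ∀ a, a ≠ 0 → R 1 a

/-- The semiring homomorphisms to the nonnegative reals that are monotone for `R`. -/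
def spectrumOf (R : S → S → Prop) : Set (S →+* ℝ≥0) :=
  {φ | ∀ a b : S, R a b → φ a ≤ φ b}

/-! ### Elementary consequences of the axioms. -/

namespace IsStrassenPreorder

variable {R : S → S → Prop}

theorem add_left (h : IsStrassenPreorder R) {a b : S} (hab : R a b) (c : S) :
    R (c + a) (c + b) := by
  rw [add_comm c, add_comm c]; exact h.add_right hab c

theorem mul_left (h : IsStrassenPreorder R) {a b : S} (hab : R a b) (c : S) :
    R (c * a) (c * b) := by
  rw [mul_comm c, mul_comm c]; exact h.mul_right hab c

theorem add_le (h : IsStrassenPreorder R) {a b c d : S} (hab : R a b) (hcd : R c d) :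
    R (a + c) (b + d) :=
  h.trans (h.add_right hab c) (h.add_left hcd b)

theorem mul_le (h : IsStrassenPreorder R) {a b c d : S} (hab : R a b) (hcd : R c d) :
    R (a * c) (b * d) :=
  h.trans (h.mul_right hab c) (h.mul_left hcd b)

theorem pow_le (h : IsStrassenPreorder R) {a b : S} (hab : R a b) (n : ℕ) :
    R (a ^ n) (b ^ n) := by
  induction n with
  | zero => simpa using h.refl 1
  | succ n ih => rw [pow_succ, pow_succ]; exact h.mul_le ih hab

theorem cast_le (h : IsStrassenPreorder R) {n m : ℕ} (hnm : n ≤ m) : R (n : S) (m : S) := by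
  obtain ⟨k, rfl⟩ := Nat.exists_eq_add_of_le hnm
  have := h.add_left (h.zero_le (k : S)) (n : S)
  simpa using this

theorem le_add_right (h : IsStrassenPreorder R) (a b : S) : R a (a + b) := by
  simpa using h.add_left (h.zero_le b) a

theorem le_add_left (h : IsStrassenPreorder R) (a b : S) : R a (b + a) := by
  rw [add_comm]; exact h.le_add_right a b

theorem ne_zero_of_one_le (h : IsStrassenPreorder R) {a : S} (ha : R 1 a) : a ≠ 0 := by
  rintro rfl
  have : R ((1 : ℕ) : S) ((0 : ℕ) : S) := by simpa using ha
  exact absurd (h.le_of_cast this) (by norm_num)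

theorem mul_ne_zero (h : IsStrassenPreorder R) {a b : S} (ha : a ≠ 0) (hb : b ≠ 0) :
    a * b ≠ 0 := by
  apply h.ne_zero_of_one_le
  simpa using h.mul_le (h.one_le a ha) (h.one_le b hb)

theorem one_le_pow (h : IsStrassenPreorder R) {a : S} (ha : R 1 a) (n : ℕ) : R 1 (a ^ n) := by
  simpa using h.pow_le ha n

/-- Powers of an inequality that holds up to a common factor. -/
theorem mul_pow_le (h : IsStrassenPreorder R) {s a b : S} (hab : R (s * a) (s * b)) (n : ℕ) :
    R (s * a ^ n) (s * b ^ n) := by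
  induction n with
  | zero => simpa using h.refl s
  | succ n ih =>
    have h1 := h.mul_right ih a
    have h2 := h.mul_right hab (b ^ n)
    rw [show s * a ^ (n + 1) = s * a ^ n * a by ring,
      show s * b ^ (n + 1) = s * b * b ^ n by ring]
    refine h.trans h1 ?_
    rwa [show s * b ^ n * a = s * a * b ^ n by ring]

/-- The summand `c` acts as a catalyst: it is returned after each replacement of an `x` by a `y`, so
a single copy serves for all `N`. This turns an inequality with a common summand into an instance of
`archClosure`. -/
theorem le_nsmul_add_of_add_le (h : IsStrassenPreorder R) {x y c : S} (hxy : R (c + x) (c + y))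
    (N : ℕ) : R (N * x) (N * y + c) := by
  have key : R (c + N * x) (c + N * y) := by
    induction N with
    | zero => simpa using h.refl c
    | succ N ih =>
      have h1 := h.add_right ih x
      have h2 := h.add_right hxy (N * y)
      rw [show c + ((N + 1 : ℕ) : S) * x = c + N * x + x by push_cast; ring,
        show c + ((N + 1 : ℕ) : S) * y = c + y + N * y by push_cast; ring]
      refine h.trans h1 ?_
      rwa [show c + N * y + x = c + x + N * y by ring]
  rw [add_comm _ c]
  exact h.trans (h.le_add_left _ c) key

end IsStrassenPreorder

/-! ### Removing bounded errors in the reals, and three enlargements of a preorder. -/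

theorem le_of_forall_pow_le_mul_pow {x y C : ℝ} (hy : 0 ≤ y)
    (h : ∀ n : ℕ, x ^ n ≤ C * y ^ n) : x ≤ y := by
  by_contra! hlt
  rcases hy.eq_or_lt with rfl | hy
  · have := h 1
    simp at this
    linarith
  · have h1 : 1 < x / y := (one_lt_div hy).2 hlt
    obtain ⟨n, hn⟩ := pow_unbounded_of_one_lt C h1
    rw [div_pow, lt_div_iff₀ (pow_pos hy n)] at hn
    exact absurd (h n) (not_le.2 hn)

theorem le_of_forall_nat_mul_le {x y C : ℝ} (h : ∀ N : ℕ, N * x ≤ N * y + C) : x ≤ y := by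
  by_contra! hlt
  obtain ⟨N, hN⟩ := exists_nat_gt (C / (x - y))
  rw [div_lt_iff₀ (sub_pos.2 hlt)] at hN
  linarith [h N]

/-- The Archimedean closure of a preorder. -/
def archClosure (R : S → S → Prop) (a b : S) : Prop :=
  ∃ c : ℕ, ∀ N : ℕ, R (N * a) (N * b + c)

/-- The closure of a preorder under cancellation of nonzero factors. -/
def cancelClosure (R : S → S → Prop) (a b : S) : Prop :=
  ∃ s : S, s ≠ 0 ∧ R (s * a) (s * b)

/-- The preorder obtained by adjoining the relation `x ≤ y`. -/
def adjoinRel (R : S → S → Prop) (x y : S) (a b : S) : Prop :=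
  ∃ s : S, R (a + s * y) (b + s * x)

namespace IsStrassenPreorder

variable {R : S → S → Prop}

theorem le_archClosure (h : IsStrassenPreorder R) {a b : S} (hab : R a b) :
    archClosure R a b :=
  ⟨0, fun N => by simpa using h.mul_left hab N⟩

theorem le_cancelClosure (h : IsStrassenPreorder R) {a b : S} (hab : R a b) :
    cancelClosure R a b :=
  ⟨1, h.ne_zero_of_one_le (h.refl 1), by simpa using hab⟩

theorem le_adjoinRel {a b : S} (hab : R a b) (x y : S) :
    adjoinRel R x y a b :=
  ⟨0, by simpa using hab⟩

/-- No collapse occurs on the integers: `N * n ≤ N * m + p` for all `N` forces `n ≤ m`. -/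
theorem archClosure (h : IsStrassenPreorder R) :
    IsStrassenPreorder (archClosure R) where
  refl a := h.le_archClosure (h.refl a)
  trans := by
    rintro a b c ⟨p, hp⟩ ⟨q, hq⟩
    refine ⟨q + p, fun N => h.trans (hp N) ?_⟩
    have := h.add_right (hq N) (p : S)
    rwa [show (N : S) * c + ((q + p : ℕ) : S) = N * c + q + p by push_cast; ring]
  add_right := by
    rintro a b ⟨p, hp⟩ c
    refine ⟨p, fun N => ?_⟩
    have := h.add_right (hp N) (N * c)
    rwa [mul_add, mul_add, add_right_comm]
  mul_right := by
    rintro a b ⟨p, hp⟩ c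
    -- Multiplication turns the error `p` into `p * c`, which has to be replaced by an integer.
    obtain ⟨r, hr⟩ := h.bounded c
    refine ⟨p * r, fun N => ?_⟩
    have h1 := h.mul_right (hp N) c
    rw [add_mul, mul_assoc, mul_assoc] at h1
    refine h.trans h1 (h.add_left ?_ _)
    push_cast
    exact h.mul_left hr p
  le_of_cast := by
    rintro n m ⟨p, hp⟩
    have h1 : ∀ N : ℕ, N * n ≤ N * m + p := fun N => h.le_of_cast (by
      have := hp N
      push_cast
      exact this)
    have h2 : (n : ℝ) ≤ m := le_of_forall_nat_mul_le (C := p) fun N => by exact_mod_cast h1 N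
    exact_mod_cast h2
  zero_le a := h.le_archClosure (h.zero_le a)
  bounded a := (h.bounded a).imp fun _ => h.le_archClosure
  one_le a ha := h.le_archClosure (h.one_le a ha)

theorem cancelClosure (h : IsStrassenPreorder R) :
    IsStrassenPreorder (cancelClosure R) where
  refl a := h.le_cancelClosure (h.refl a)
  trans := by
    rintro a b c ⟨s, hs, h1⟩ ⟨t, ht, h2⟩
    refine ⟨s * t, h.mul_ne_zero hs ht, ?_⟩
    have h1 := h.mul_right h1 t
    have h2 := h.mul_right h2 s
    rw [show s * t * a = s * a * t by ring, show s * t * c = t * c * s by ring]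
    refine h.trans h1 ?_
    rwa [show s * b * t = t * b * s by ring]
  add_right := by
    rintro a b ⟨s, hs, h1⟩ c
    refine ⟨s, hs, ?_⟩
    rw [mul_add, mul_add]
    exact h.add_right h1 _
  mul_right := by
    rintro a b ⟨s, hs, h1⟩ c
    refine ⟨s, hs, ?_⟩
    rw [← mul_assoc, ← mul_assoc]
    exact h.mul_right h1 _
  le_of_cast := by
    rintro n m ⟨s, hs, h1⟩
    obtain ⟨r, hr⟩ := h.bounded s
    -- The factor `s` survives all powers by `mul_pow_le`. Since `1 ≤ s ≤ r`, removing it costs only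
    -- the constant `r`, which is negligible as `N` grows.
    have h2 : ∀ N : ℕ, n ^ N ≤ r * m ^ N := fun N => h.le_of_cast (by
      have h3 := h.mul_right (h.one_le s hs) ((n : S) ^ N)
      have h4 := h.mul_right hr ((m : S) ^ N)
      push_cast
      rw [one_mul] at h3
      exact h.trans h3 (h.trans (h.mul_pow_le h1 N) h4))
    have h3 : (n : ℝ) ≤ m :=
      le_of_forall_pow_le_mul_pow (C := r) (Nat.cast_nonneg m) fun N => by exact_mod_cast h2 N
    exact_mod_cast h3
  zero_le a := h.le_cancelClosure (h.zero_le a)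
  bounded a := (h.bounded a).imp fun _ => h.le_cancelClosure
  one_le a ha := h.le_cancelClosure (h.one_le a ha)

/-- The hypothesis says that the enlarged relation never places `n + 1` below `n`. This is the only
way in which adjoining `x ≤ y` could fail. -/
theorem adjoinRel (h : IsStrassenPreorder R) {x y : S}
    (hxy : ∀ (n : ℕ) (s : S), ¬ R (n + (1 + s * y)) (n + s * x)) :
    IsStrassenPreorder (adjoinRel R x y) where
  refl a := le_adjoinRel (h.refl a) x y
  trans := by
    rintro a b c ⟨s, h1⟩ ⟨t, h2⟩
    refine ⟨s + t, ?_⟩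
    have h1 := h.add_right h1 (t * y)
    have h2 := h.add_right h2 (s * x)
    rw [show a + (s + t) * y = a + s * y + t * y by ring,
      show c + (s + t) * x = c + t * x + s * x by ring]
    refine h.trans h1 ?_
    rwa [show b + s * x + t * y = b + t * y + s * x by ring]
  add_right := by
    rintro a b ⟨s, h1⟩ c
    refine ⟨s, ?_⟩
    rw [add_right_comm, add_right_comm b]
    exact h.add_right h1 c
  mul_right := by
    rintro a b ⟨s, h1⟩ c
    refine ⟨s * c, ?_⟩
    have := h.mul_right h1 c
    rwa [show a * c + s * c * y = (a + s * y) * c by ring,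
      show b * c + s * c * x = (b + s * x) * c by ring]
  le_of_cast := by
    rintro n m ⟨s, h1⟩
    by_contra! hlt
    refine hxy m s (h.trans ?_ h1)
    have := h.add_right (h.cast_le (Nat.succ_le_of_lt hlt)) (s * y)
    rwa [← add_assoc, show (m : S) + 1 = (m.succ : ℕ) by push_cast; ring]
  zero_le a := le_adjoinRel (h.zero_le a) x y
  bounded a := by
    obtain ⟨n, hn⟩ := h.bounded a
    exact ⟨n, le_adjoinRel hn x y⟩
  one_le a ha := le_adjoinRel (h.one_le a ha) x y

theorem adjoinRel_self (h : IsStrassenPreorder R) (x y : S) : NonnegMatrix.adjoinRel R x y x y :=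
  ⟨1, by rw [one_mul, one_mul, add_comm]; exact h.refl _⟩

/-- Every Strassen preorder extends to a maximal one. -/
theorem exists_maximal (h : IsStrassenPreorder R) :
    ∃ Q : S → S → Prop, R ≤ Q ∧ Maximal IsStrassenPreorder Q := by
  refine zorn_le_nonempty₀ {Q : S → S → Prop | IsStrassenPreorder Q} ?_ R h
  intro c hc hchain Q hQ
  have hQ' : IsStrassenPreorder Q := hc hQ
  -- Each axiom involves finitely many inequalities, so it passes to the union of the chain. The
  -- given member `Q` supplies those that need no premise.
  have mem : ∀ {a b : S}, Q a b → ∃ T ∈ c, T a b := fun hab => ⟨Q, hQ, hab⟩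
  refine ⟨fun a b => ∃ T ∈ c, T a b, ?_, fun T hT a b hab => ⟨T, hT, hab⟩⟩
  exact
    { refl := fun a => mem (hQ'.refl a)
      trans := by
        rintro a b d ⟨T, hT, h1⟩ ⟨U, hU, h2⟩
        rcases hchain.total hT hU with hTU | hUT
        · exact ⟨U, hU, (hc hU).trans (hTU _ _ h1) h2⟩
        · exact ⟨T, hT, (hc hT).trans h1 (hUT _ _ h2)⟩
      add_right := by
        rintro a b ⟨T, hT, h1⟩ d
        exact ⟨T, hT, (hc hT).add_right h1 d⟩
      mul_right := by
        rintro a b ⟨T, hT, h1⟩ d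
        exact ⟨T, hT, (hc hT).mul_right h1 d⟩
      le_of_cast := by
        rintro n m ⟨T, hT, h1⟩
        exact (hc hT).le_of_cast h1
      zero_le := fun a => mem (hQ'.zero_le a)
      bounded := fun a => (hQ'.bounded a).imp fun _ => mem
      one_le := fun a ha => mem (hQ'.one_le a ha) }

/-- A maximal Strassen preorder is total. -/
theorem total_of_maximal (h : Maximal IsStrassenPreorder R) (a b : S) : R a b ∨ R b a := by
  have hR : IsStrassenPreorder R := h.prop
  by_cases hfail : ∀ (n : ℕ) (s : S), ¬ R (n + (1 + s * b)) (n + s * a)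
  · exact Or.inl (h.le_of_ge (hR.adjoinRel hfail) (fun _ _ h' => le_adjoinRel h' a b) _ _
      (hR.adjoinRel_self a b))
  -- If `a ≤ b` cannot be adjoined, the obstruction yields `b ≤ a`: the Archimedean closure cancels
  -- the summand `n`, the cancellation closure cancels `s`, and maximality says that neither
  -- enlarges `R`.
  · push Not at hfail
    obtain ⟨n, s, hs⟩ := hfail
    have hs0 : s ≠ 0 := by
      rintro rfl
      have h1 : R ((n + 1 : ℕ) : S) (n : S) := by simpa using hs
      exact absurd (hR.le_of_cast h1) (by omega)
    have h1 : R (n + s * b) (n + s * a) :=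
      hR.trans (hR.add_left (hR.le_add_left _ 1) _) hs
    have h2 : R (s * b) (s * a) :=
      h.le_of_ge hR.archClosure (fun _ _ => hR.le_archClosure) _ _
        ⟨n, fun N => hR.le_nsmul_add_of_add_le h1 N⟩
    exact Or.inr (h.le_of_ge hR.cancelClosure (fun _ _ => hR.le_cancelClosure) _ _
      ⟨s, hs0, h2⟩)

/-- Totality locates every element between consecutive integers. Applied to `N * a`, this
approximates `a` to within `1 / N`. -/
theorem exists_floor (h : IsStrassenPreorder R) (htot : ∀ a b, R a b ∨ R b a) (a : S) :
    ∃ n : ℕ, R n a ∧ R a ((n + 1 : ℕ) : S) := by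
  classical
  have hex : ∃ n : ℕ, R a ((n + 1 : ℕ) : S) := by
    obtain ⟨n, hn⟩ := h.bounded a
    exact ⟨n, h.trans hn (h.cast_le n.le_succ)⟩
  refine ⟨Nat.find hex, ?_, Nat.find_spec hex⟩
  rcases Nat.eq_zero_or_pos (Nat.find hex) with h0 | h0
  · rw [h0]; simpa using h.zero_le a
  · have := Nat.find_min hex (Nat.sub_lt h0 one_pos)
    rw [Nat.sub_add_cancel (show 1 ≤ Nat.find hex from h0)] at this
    exact (htot _ _).resolve_right this

/-- A total Strassen preorder has a spectral point. -/
theorem spectrumOf_nonempty_of_total (h : IsStrassenPreorder R) (htot : ∀ a b, R a b ∨ R b a) :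
    (spectrumOf R).Nonempty := by
  -- The upper half of a Dedekind cut. `hup` and `hlow` show that integer bounds on multiples of `a`
  -- become real bounds on `f a`, and monotonicity and additivity then follow with errors bounded
  -- independently of `N`.
  let U : S → Set ℝ := fun a => {x | ∃ n m : ℕ, 0 < m ∧ R (m * a) n ∧ x = n / m}
  have hbdd : ∀ a, BddBelow (U a) := fun a => ⟨0, by
    rintro x ⟨n, m, -, -, rfl⟩; positivity⟩
  have hne : ∀ a, (U a).Nonempty := fun a => by
    obtain ⟨n, hn⟩ := h.bounded a
    exact ⟨n / (1 : ℕ), n, 1, one_pos, by simpa using hn, rfl⟩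
  let f : S → ℝ := fun a => sInf (U a)
  have hup : ∀ a (n m : ℕ), R (m * a) n → m * f a ≤ n := by
    intro a n m hnm
    rcases Nat.eq_zero_or_pos m with rfl | hm
    · simp
    · have : f a ≤ n / m := csInf_le (hbdd a) ⟨n, m, hm, hnm, rfl⟩
      have hm' : (0 : ℝ) < m := by exact_mod_cast hm
      rwa [le_div_iff₀ hm', mul_comm] at this
  have hlow : ∀ a (n m : ℕ), R n (m * a) → (n : ℝ) ≤ m * f a := by
    intro a n m hnm
    rcases Nat.eq_zero_or_pos m with rfl | hm
    · have : R (n : S) ((0 : ℕ) : S) := by simpa using hnm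
      have := h.le_of_cast this
      simp_all
    · have hm' : (0 : ℝ) < m := by exact_mod_cast hm
      rw [← div_le_iff₀' hm']
      refine le_csInf (hne a) ?_
      rintro x ⟨n', m', hm1, h1, rfl⟩
      have hm1' : (0 : ℝ) < m' := by exact_mod_cast hm1
      rw [div_le_div_iff₀ hm' hm1']
      have h2 : R ((n * m' : ℕ) : S) ((n' * m : ℕ) : S) := by
        push_cast
        refine h.trans (h.mul_right hnm m') ?_
        rw [show (m : S) * a * m' = m' * a * m by ring]
        exact h.mul_right h1 m
      exact_mod_cast h.le_of_cast h2
  have hf0 : ∀ a, 0 ≤ f a := fun a => by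
    simpa using hlow a 0 1 (by simpa using h.zero_le a)
  have hcast : ∀ n : ℕ, f n = n := fun n => le_antisymm
    (by simpa using hup n n 1 (by simpa using h.refl (n : S)))
    (by simpa using hlow n n 1 (by simpa using h.refl (n : S)))
  have hmono : ∀ a b, R a b → f a ≤ f b := by
    intro a b hab
    refine le_of_forall_nat_mul_le (C := 1) fun N => ?_
    obtain ⟨n, h1, h2⟩ := h.exists_floor htot (N * b)
    have h3 := hlow _ _ _ h1
    have h4 := hup a _ N (h.trans (h.mul_left hab N) h2)
    push_cast at h4
    linarith
  have hadd : ∀ a b, f (a + b) = f a + f b := by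
    intro a b
    have key : ∀ N : ℕ, N * f (a + b) ≤ N * (f a + f b) + 2 ∧
        N * (f a + f b) ≤ N * f (a + b) + 2 := by
      intro N
      obtain ⟨n, h1, h2⟩ := h.exists_floor htot (N * a)
      obtain ⟨m, h3, h4⟩ := h.exists_floor htot (N * b)
      have k1 := hlow _ _ _ h1
      have k2 := hup _ _ _ h2
      have k3 := hlow _ _ _ h3
      have k4 := hup _ _ _ h4
      have k5 := hlow (a + b) (n + m) N (by push_cast; rw [mul_add]; exact h.add_le h1 h3)
      have k6 := hup (a + b) ((n + 1) + (m + 1)) N (by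
        rw [Nat.cast_add, mul_add]; exact h.add_le h2 h4)
      push_cast at *
      constructor <;> linarith
    exact le_antisymm (le_of_forall_nat_mul_le fun N => (key N).1)
      (le_of_forall_nat_mul_le fun N => (key N).2)
  have hmul : ∀ a b, f (a * b) = f a * f b := by
    intro a b
    -- Multiplying the floors of `N * a` and `N * b` gives an error linear in `N` at scale `N * N`.
    -- Dividing by `N` leaves a bounded error.
    have key : ∀ N : ℕ, 0 < N → N * f (a * b) ≤ N * (f a * f b) + (f a + f b + 1) ∧
        N * (f a * f b) ≤ N * f (a * b) + (f a + f b + 1) := by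
      intro N hN
      have hN' : (1 : ℝ) ≤ N := by exact_mod_cast hN
      obtain ⟨n, h1, h2⟩ := h.exists_floor htot (N * a)
      obtain ⟨m, h3, h4⟩ := h.exists_floor htot (N * b)
      have k1 := hlow _ _ _ h1
      have k2 := hup _ _ _ h2
      have k3 := hlow _ _ _ h3
      have k4 := hup _ _ _ h4
      have e : ((N * N : ℕ) : S) * (a * b) = N * a * (N * b) := by push_cast; ring
      have k5 := hlow (a * b) (n * m) (N * N) (by
        rw [e]; push_cast; exact h.mul_le h1 h3)
      have k6 := hup (a * b) ((n + 1) * (m + 1)) (N * N) (by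
        rw [e, Nat.cast_mul]; exact h.mul_le h2 h4)
      push_cast at *
      have p1 : (n : ℝ) * m ≤ N * f a * (N * f b) :=
        mul_le_mul k1 k3 (by positivity) (mul_nonneg (by positivity) (hf0 a))
      have p2 : N * f a * (N * f b) ≤ ((n : ℝ) + 1) * (m + 1) :=
        mul_le_mul k2 k4 (mul_nonneg (by positivity) (hf0 b)) (by positivity)
      constructor <;> refine le_of_mul_le_mul_left ?_ (zero_lt_one.trans_le hN') <;> nlinarith
    have hC : 0 ≤ f a + f b + 1 := by linarith [hf0 a, hf0 b]
    refine le_antisymm (le_of_forall_nat_mul_le (C := f a + f b + 1) fun N => ?_)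
      (le_of_forall_nat_mul_le (C := f a + f b + 1) fun N => ?_) <;>
    · rcases Nat.eq_zero_or_pos N with rfl | hN
      · simpa using hC
      · first | exact (key N hN).1 | exact (key N hN).2
  refine ⟨{ toFun := fun a => ⟨f a, hf0 a⟩
            map_one' := ?_
            map_mul' := fun a b => NNReal.eq (hmul a b)
            map_zero' := ?_
            map_add' := fun a b => NNReal.eq (hadd a b) }, fun a b hab => hmono a b hab⟩
  · exact NNReal.eq (show f 1 = 1 by simpa using hcast 1)
  · exact NNReal.eq (show f 0 = 0 by simpa using hcast 0)

theorem spectrumOf_nonempty (h : IsStrassenPreorder R) : (spectrumOf R).Nonempty := by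
  obtain ⟨Q, hRQ, hQ⟩ := h.exists_maximal
  obtain ⟨φ, hφ⟩ := hQ.prop.spectrumOf_nonempty_of_total (total_of_maximal hQ)
  exact ⟨φ, fun a b hab => hφ a b (hRQ a b hab)⟩

/-- If `φ y < φ x` for every spectral point `φ`, then powers of `y` are bounded by powers of `x`,
up to controlled factors. -/
theorem pow_le_of_forall_lt (h : IsStrassenPreorder R) {x y : S} (hx : R 1 x)
    (hlt : ∀ φ ∈ spectrumOf R, φ y < φ x) :
    ∃ r : ℕ, ∀ j : ℕ, ∃ c : ℕ, ∀ L : ℕ,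
      R (y ^ (j * L)) (c * (r ^ L * x ^ (j * L))) := by
  -- Otherwise `x ≤ y` could be adjoined, and a spectral point of the larger preorder would satisfy
  -- `φ x ≤ φ y`.
  have hfail : ¬ ∀ (n : ℕ) (s : S), ¬ R (n + (1 + s * y)) (n + s * x) := by
    intro hok
    obtain ⟨φ, hφ⟩ := (h.adjoinRel hok).spectrumOf_nonempty
    exact absurd (hφ x y (h.adjoinRel_self x y))
      (not_le.2 (hlt φ fun a b hab => hφ a b (le_adjoinRel hab x y)))
  push Not at hfail
  obtain ⟨n, s, hs⟩ := hfail
  have hs0 : s ≠ 0 := by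
    rintro rfl
    have h1 : R ((n + 1 : ℕ) : S) (n : S) := by simpa using hs
    exact absurd (h.le_of_cast h1) (by omega)
  have h1 : R (n + s * y) (n + s * x) := h.trans (h.add_left (h.le_add_left _ 1) _) hs
  have ha := h.archClosure
  have h2 : NonnegMatrix.archClosure R (s * y) (s * x) :=
    ⟨n, fun N => h.le_nsmul_add_of_add_le h1 N⟩
  obtain ⟨r, hr⟩ := h.bounded s
  refine ⟨r + 1, fun j => ?_⟩
  have h3 : NonnegMatrix.archClosure R (y ^ j) (r * x ^ j) := by
    have k1 := ha.mul_right (ha.one_le s hs0) (y ^ j)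
    rw [one_mul] at k1
    exact ha.trans k1 (ha.trans (ha.mul_pow_le h2 j)
      (ha.mul_right (h.le_archClosure hr) _))
  obtain ⟨c, hc⟩ := h3
  -- The Archimedean error is fed back into the main term: `c ≤ (c + 1) * x ^ j` because `1 ≤ x`, so
  -- raising `r` to `r + 1` absorbs it. The factor `c + 1` is now common to both sides and is not
  -- raised to the power `L`.
  have h4 : R (((c + 1 : ℕ) : S) * y ^ j) (((c + 1 : ℕ) : S) * ((r + 1 : ℕ) * x ^ j)) := by
    refine h.trans (hc (c + 1)) ?_
    rw [show ((c + 1 : ℕ) : S) * ((r + 1 : ℕ) * x ^ j) =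
      ((c + 1 : ℕ) : S) * (r * x ^ j) + (c + 1 : ℕ) * x ^ j by push_cast; ring]
    refine h.add_left (h.trans (h.cast_le c.le_succ) ?_) _
    simpa using h.mul_left (h.one_le_pow hx j) ((c + 1 : ℕ) : S)
  refine ⟨c + 1, fun L => ?_⟩
  have h5 := h.mul_pow_le h4 L
  rw [mul_pow, ← pow_mul, ← pow_mul] at h5
  refine h.trans ?_ h5
  have h6 := h.mul_right (h.cast_le (Nat.succ_le_succ c.zero_le)) (y ^ (j * L))
  simpa using h6

/-- The values of the spectral points at `a` form a compact set. -/
theorem isCompact_spectrumOf_values (h : IsStrassenPreorder R) (a : S) :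
    IsCompact {x : ℝ≥0 | ∃ φ ∈ spectrumOf R, x = φ a} := by
  choose r hr using h.bounded
  let K : Set (S → ℝ≥0) := {f | f 0 = 0 ∧ f 1 = 1 ∧ (∀ x y, f (x + y) = f x + f y) ∧
    (∀ x y, f (x * y) = f x * f y) ∧ ∀ x y, R x y → f x ≤ f y}
  have hKpt : ∀ f ∈ K, ∃ φ ∈ spectrumOf R, ∀ x, φ x = f x := by
    rintro f ⟨h0, h1, hadd, hmul, hmono⟩
    exact ⟨{ toFun := f, map_one' := h1, map_mul' := hmul, map_zero' := h0, map_add' := hadd },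
      hmono, fun _ => rfl⟩
  have hclosed : IsClosed K := by
    have e : K = {f | f 0 = 0} ∩ ({f | f 1 = 1} ∩ ((⋂ x, ⋂ y, {f | f (x + y) = f x + f y}) ∩
        ((⋂ x, ⋂ y, {f | f (x * y) = f x * f y}) ∩
          ⋂ x, ⋂ y, ⋂ (_ : R x y), {f | f x ≤ f y}))) := by
      ext f; simp [K]
    rw [e]
    refine (isClosed_eq (by fun_prop) (by fun_prop)).inter
      ((isClosed_eq (by fun_prop) (by fun_prop)).inter (IsClosed.inter ?_ (IsClosed.inter ?_ ?_)))
    · exact isClosed_iInter fun x => isClosed_iInter fun y =>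
        isClosed_eq (by fun_prop) (by fun_prop)
    · exact isClosed_iInter fun x => isClosed_iInter fun y =>
        isClosed_eq (by fun_prop) (by fun_prop)
    · exact isClosed_iInter fun x => isClosed_iInter fun y => isClosed_iInter fun _ =>
        isClosed_le (by fun_prop) (by fun_prop)
  -- Tychonoff: every spectral value at `x` lies between `0` and the integer bound `r x`, and the
  -- homomorphism and monotonicity conditions are closed.
  have hcomp : IsCompact K := by
    refine (isCompact_univ_pi fun x => isCompact_Icc (a := (0 : ℝ≥0))
      (b := (r x : ℝ≥0))).of_isClosed_subset hclosed fun f hf x _ => ?_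
    obtain ⟨φ, hφ, hfφ⟩ := hKpt f hf
    refine ⟨bot_le, ?_⟩
    rw [← hfφ]
    simpa using hφ x (r x) (hr x)
  convert hcomp.image (continuous_apply a) using 1
  ext x
  constructor
  · rintro ⟨φ, hφ, rfl⟩
    exact ⟨φ, ⟨map_zero φ, map_one φ, map_add φ, map_mul φ, hφ⟩, rfl⟩
  · rintro ⟨f, hf, rfl⟩
    obtain ⟨φ, hφ, hfφ⟩ := hKpt f hf
    exact ⟨φ, hφ, (hfφ a).symm⟩

end IsStrassenPreorder

end Strassen

/-! ### Asymptotic rank and subrank in a Strassen preorder -/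

/-- Fekete's lemma, exponentiated. The quotient `v n / n` carries no information at `n = 0`, which
is why `0 ≤ v 0` is assumed. -/
theorem exists_tendsto_exp_of_subadditive {v : ℕ → ℝ} (hv : Subadditive v)
    (hb : BddBelow (Set.range fun n => v n / n)) (h0 : 0 ≤ v 0) :
    ∃ l : ℝ, Filter.Tendsto (fun n : ℕ => Real.exp (v n) ^ (1 / (n : ℝ))) Filter.atTop
      (𝓝 (Real.exp l)) ∧ ∀ n : ℕ, n * l ≤ v n := by
  refine ⟨hv.lim, ?_, fun n => ?_⟩
  · have := (Real.continuous_exp.tendsto _).comp (hv.tendsto_lim hb)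
    refine this.congr fun n => ?_
    rw [← Real.exp_mul]
    simp [div_eq_mul_inv]
  · rcases Nat.eq_zero_or_pos n with rfl | hn
    · simpa using h0
    · have := hv.lim_le_div hb hn.ne'
      rwa [le_div_iff₀ (by exact_mod_cast hn), mul_comm] at this

/-- Fekete's lemma for submultiplicative sequences. -/
theorem exists_tendsto_of_submultiplicative {u : ℕ → ℝ} (h1 : ∀ n, 1 ≤ u n)
    (hu : ∀ m n, u (m + n) ≤ u m * u n) :
    ∃ ρ : ℝ, 0 ≤ ρ ∧ Filter.Tendsto (fun n : ℕ => u n ^ (1 / (n : ℝ))) Filter.atTop (𝓝 ρ) ∧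
      ∀ n, ρ ^ n ≤ u n := by
  have hpos : ∀ n, 0 < u n := fun n => zero_lt_one.trans_le (h1 n)
  have hv : Subadditive fun n => Real.log (u n) := fun m n => by
    rw [← Real.log_mul (hpos m).ne' (hpos n).ne']
    exact Real.log_le_log (hpos _) (hu m n)
  obtain ⟨l, hl, hle⟩ := exists_tendsto_exp_of_subadditive hv
    ⟨0, by rintro _ ⟨n, rfl⟩; exact div_nonneg (Real.log_nonneg (h1 n)) n.cast_nonneg⟩
    (Real.log_nonneg (h1 0))
  refine ⟨Real.exp l, (Real.exp_pos l).le, ?_, fun n => ?_⟩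
  · simpa only [Real.exp_log (hpos _)] using hl
  · rw [← Real.exp_nat_mul, ← Real.exp_log (hpos n)]
    exact Real.exp_le_exp.2 (hle n)

/-- Fekete's lemma for supermultiplicative sequences. -/
theorem exists_tendsto_of_supermultiplicative {u : ℕ → ℝ} {C : ℝ} (h1 : ∀ n, 1 ≤ u n)
    (hu : ∀ m n, u m * u n ≤ u (m + n)) (hC : ∀ n, u n ≤ C ^ n) :
    ∃ σ : ℝ, 1 ≤ σ ∧ Filter.Tendsto (fun n : ℕ => u n ^ (1 / (n : ℝ))) Filter.atTop (𝓝 σ) ∧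
      ∀ n, u n ≤ σ ^ n := by
  have hpos : ∀ n, 0 < u n := fun n => zero_lt_one.trans_le (h1 n)
  have hv : Subadditive fun n => -Real.log (u n) := fun m n => by
    rw [← neg_add, ← Real.log_mul (hpos m).ne' (hpos n).ne']
    exact neg_le_neg (Real.log_le_log (mul_pos (hpos m) (hpos n)) (hu m n))
  -- The bound at exponent zero fixes `u 0`, so that `-log (u 0)` is nonnegative.
  have hu0 : u 0 = 1 := le_antisymm (by simpa using hC 0) (h1 0)
  have hlog : ∀ n : ℕ, Real.log (u n) ≤ n * Real.log C := fun n => by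
    rw [← Real.log_pow]; exact Real.log_le_log (hpos n) (hC n)
  have hlogC : 0 ≤ Real.log C := by
    have := hlog 1
    rw [Nat.cast_one, one_mul] at this
    exact (Real.log_nonneg (h1 1)).trans this
  obtain ⟨l, hl, hle⟩ := exists_tendsto_exp_of_subadditive hv
    ⟨-Real.log C, by
      rintro _ ⟨n, rfl⟩
      dsimp only
      rw [neg_div, neg_le_neg_iff]
      exact div_le_of_le_mul₀ n.cast_nonneg hlogC (by rw [mul_comm]; exact hlog n)⟩
    (by simp [hu0])
  have hbound : ∀ n, u n ≤ Real.exp (-l) ^ n := fun n => by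
    rw [← Real.exp_nat_mul, ← Real.exp_log (hpos n)]
    have := hle n
    exact Real.exp_le_exp.2 (by linarith)
  refine ⟨Real.exp (-l), by simpa using (h1 1).trans (hbound 1), ?_, hbound⟩
  rw [Real.exp_neg]
  refine (hl.inv₀ (Real.exp_pos l).ne').congr fun n => ?_
  rw [Real.exp_neg, Real.exp_log (hpos n), Real.inv_rpow (hpos n).le, inv_inv]

section Strassen

variable {S : Type} [CommSemiring S] {R : S → S → Prop}

namespace IsStrassenPreorder

theorem one_le_apply {φ : S →+* ℝ≥0} (hφ : φ ∈ spectrumOf R) {a : S} (ha : R 1 a) :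
    (1 : ℝ) ≤ φ a := by
  have := hφ _ _ ha
  rw [map_one] at this
  exact_mod_cast this

theorem le_apply_of_tendsto {φ : S →+* ℝ≥0} (hφ : φ ∈ spectrumOf R) {a : S} {u : ℕ → ℕ}
    (hu : ∀ k, R (u k) (a ^ k)) {σ : ℝ}
    (hσ : Filter.Tendsto (fun k : ℕ => (u k : ℝ) ^ (1 / (k : ℝ))) Filter.atTop (𝓝 σ)) :
    σ ≤ φ a := by
  refine le_of_tendsto hσ ?_
  filter_upwards [Filter.eventually_gt_atTop 0] with k hk
  have h2 := hφ _ _ (hu k)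
  rw [map_pow, map_natCast] at h2
  have h3 : (u k : ℝ) ≤ (φ a : ℝ) ^ k := by exact_mod_cast h2
  rw [one_div]
  exact (Real.rpow_inv_le_iff_of_pos (by positivity) (φ a).coe_nonneg
    (by exact_mod_cast hk)).2 (by rwa [Real.rpow_natCast])

/-- The asymptotic rank exists and is the maximum over the spectrum. -/
theorem tendsto_rank (h : IsStrassenPreorder R) {a : S} (ha : a ≠ 0) {rk : ℕ → ℕ}
    (hrk : ∀ k n, rk k ≤ n ↔ R (a ^ k) n) :
    ∃ ρ : ℝ, Filter.Tendsto (fun k : ℕ => (rk k : ℝ) ^ (1 / (k : ℝ))) Filter.atTop (𝓝 ρ) ∧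
      IsGreatest {x : ℝ | ∃ φ ∈ spectrumOf R, x = φ a} ρ := by
  have h1a := h.one_le a ha
  have hpow : ∀ k, R (a ^ k) (rk k) := fun k => (hrk k _).1 le_rfl
  have h1 : ∀ k, (1 : ℝ) ≤ rk k := fun k => by
    have : R ((1 : ℕ) : S) (rk k) := by
      rw [Nat.cast_one]; exact h.trans (h.one_le_pow h1a k) (hpow k)
    exact_mod_cast h.le_of_cast this
  obtain ⟨ρ, hρ0, hρ, hle⟩ := exists_tendsto_of_submultiplicative h1 fun m n => by
    have : rk (m + n) ≤ rk m * rk n := (hrk _ _).2 (by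
      rw [pow_add, Nat.cast_mul]; exact h.mul_le (hpow m) (hpow n))
    exact_mod_cast this
  have hub : ∀ φ ∈ spectrumOf R, (φ a : ℝ) ≤ ρ := by
    intro φ hφ
    refine ge_of_tendsto hρ ?_
    filter_upwards [Filter.eventually_gt_atTop 0] with k hk
    have h2 := hφ _ _ (hpow k)
    rw [map_pow, map_natCast] at h2
    have h3 : (φ a : ℝ) ^ k ≤ rk k := by exact_mod_cast h2
    rw [one_div]
    exact (Real.le_rpow_inv_iff_of_pos (φ a).coe_nonneg (by positivity)
      (by exact_mod_cast hk)).2 (by rwa [Real.rpow_natCast])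
  obtain ⟨φ₀, hφ₀⟩ := h.spectrumOf_nonempty
  obtain ⟨_, ⟨φ, hφ, rfl⟩, hmax⟩ :=
    (h.isCompact_spectrumOf_values a).exists_isGreatest ⟨φ₀ a, φ₀, hφ₀, rfl⟩
  have hμ : (1 : ℝ) ≤ φ a := one_le_apply hφ h1a
  have key : ρ ≤ φ a := by
    refine le_of_forall_pow_le_mul_pow (C := 2) (φ a).coe_nonneg fun k => ?_
    -- The least integer strictly above every spectral value of `a ^ k`; strictness is what
    -- `pow_le_of_forall_lt` needs. The rounding loses at most a factor `2`, which vanishes as `k`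
    -- grows.
    set m : ℕ := ⌊(φ a) ^ k⌋₊ + 1 with hm
    have hm1 : (φ a) ^ k < m := by rw [hm]; exact_mod_cast Nat.lt_floor_add_one _
    have hm2 : (m : ℝ) ≤ (φ a : ℝ) ^ k + 1 := by
      have : (⌊(φ a) ^ k⌋₊ : ℝ≥0) ≤ (φ a) ^ k := Nat.floor_le bot_le
      have : (⌊(φ a) ^ k⌋₊ : ℝ) ≤ (φ a : ℝ) ^ k := by exact_mod_cast this
      rw [hm]; push_cast; linarith
    have h1m : R 1 (m : S) := by simpa using h.cast_le (show 1 ≤ m by omega)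
    obtain ⟨r, hr⟩ := h.pow_le_of_forall_lt (y := a ^ k) h1m fun ψ hψ => by
      rw [map_pow, map_natCast]
      exact (pow_le_pow_left' (hmax ⟨ψ, hψ, rfl⟩) k).trans_lt hm1
    -- Growing `L` removes `c`, and then growing `j` removes `r`. The order matters because `c`
    -- depends on `j` while `r` does not.
    have h2 : ρ ^ k ≤ m := by
      refine le_of_forall_pow_le_mul_pow (C := r) m.cast_nonneg fun j => ?_
      obtain ⟨c, hc⟩ := hr j
      refine le_of_forall_pow_le_mul_pow (C := c) (by positivity) fun L => ?_
      have h3 : rk (k * (j * L)) ≤ c * (r ^ L * m ^ (j * L)) := (hrk _ _).2 (by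
        rw [pow_mul]; push_cast; exact hc L)
      rw [← pow_mul, ← pow_mul, mul_pow, ← pow_mul]
      exact (hle _).trans (by exact_mod_cast h3)
    have h4 : (1 : ℝ) ≤ (φ a : ℝ) ^ k := one_le_pow₀ hμ
    linarith
  refine ⟨ρ, hρ, ⟨φ, hφ, le_antisymm key (hub φ hφ)⟩, ?_⟩
  rintro _ ⟨ψ, hψ, rfl⟩
  exact hub ψ hψ

/-- The asymptotic subrank exists and is attained at a spectral point, if some power of `a` is at
least `2` unless `a` is at most `1`. -/
theorem tendsto_subrank (h : IsStrassenPreorder R) {a : S} (ha : a ≠ 0) {sub : ℕ → ℕ}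
    (hsub : ∀ k n, n ≤ sub k ↔ R n (a ^ k)) (hgap : R a 1 ∨ ∃ d, R 2 (a ^ d)) :
    ∃ σ : ℝ, Filter.Tendsto (fun k : ℕ => (sub k : ℝ) ^ (1 / (k : ℝ))) Filter.atTop (𝓝 σ) ∧
      IsLeast {x : ℝ | ∃ φ ∈ spectrumOf R, x = φ a} σ := by
  have h1a := h.one_le a ha
  have hpow : ∀ k, R (sub k) (a ^ k) := fun k => (hsub k _).1 le_rfl
  have h1 : ∀ k, (1 : ℝ) ≤ sub k := fun k => by
    have : 1 ≤ sub k := (hsub k 1).2 (by rw [Nat.cast_one]; exact h.one_le_pow h1a k)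
    exact_mod_cast this
  obtain ⟨C, hC⟩ := h.bounded a
  obtain ⟨σ, hσ1, hσ, hle⟩ := exists_tendsto_of_supermultiplicative (C := C) h1
    (fun m n => by
      have : sub m * sub n ≤ sub (m + n) := (hsub _ _).2 (by
        rw [pow_add, Nat.cast_mul]; exact h.mul_le (hpow m) (hpow n))
      exact_mod_cast this)
    (fun n => by
      have : sub n ≤ C ^ n := h.le_of_cast (by
        rw [Nat.cast_pow]; exact h.trans (hpow n) (h.pow_le hC n))
      exact_mod_cast this)
  have hlb : ∀ φ ∈ spectrumOf R, σ ≤ φ a := fun φ hφ => le_apply_of_tendsto hφ hpow hσ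
  obtain ⟨φ₀, hφ₀⟩ := h.spectrumOf_nonempty
  obtain ⟨_, ⟨φ, hφ, rfl⟩, hmin⟩ :=
    (h.isCompact_spectrumOf_values a).exists_isLeast ⟨φ₀ a, φ₀, hφ₀, rfl⟩
  have hν : (1 : ℝ) ≤ φ a := one_le_apply hφ h1a
  have key : (φ a : ℝ) ≤ σ := by
    rcases hgap with hle1 | ⟨d, hd⟩
    · have := hφ _ _ hle1
      rw [map_one] at this
      exact le_trans (by exact_mod_cast this) hσ1
    refine le_of_forall_pow_le_mul_pow (C := 2) (by linarith) fun k => ?_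
    -- Here `m` is the largest integer strictly below every spectral value of `a ^ k`.
    obtain ⟨m, hm⟩ : ∃ m : ℕ, ⌈(φ a) ^ k⌉₊ = m + 1 := by
      refine Nat.exists_eq_succ_of_ne_zero (Nat.ceil_pos.2 ?_).ne'
      exact pow_pos (zero_lt_one.trans_le (by exact_mod_cast hν)) k
    have hm1 : (m : ℝ≥0) < (φ a) ^ k := Nat.lt_ceil.1 (by omega)
    have hm2 : (φ a : ℝ) ^ k ≤ m + 1 := by
      have : (φ a) ^ k ≤ (⌈(φ a) ^ k⌉₊ : ℝ≥0) := Nat.le_ceil _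
      rw [hm] at this
      exact_mod_cast this
    obtain ⟨r, hr⟩ := h.pow_le_of_forall_lt (y := (m : S)) (h.one_le_pow h1a k)
      fun ψ hψ => by
        rw [map_pow, map_natCast]
        exact hm1.trans_le (pow_le_pow_left' (hmin ⟨ψ, hψ, rfl⟩) k)
    -- From `n ≤ 2 ^ n` and `2 ≤ a ^ d`: this converts the integer factors `c` and `r` into powers
    -- of `a`, at the cost of an exponent negligible against `k * (j * L)`.
    have hcast : ∀ n : ℕ, R (n : S) (a ^ (d * n)) := fun n => by
      rw [pow_mul]
      refine h.trans ?_ (h.pow_le hd n)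
      have := h.cast_le (Nat.lt_two_pow_self (n := n)).le
      push_cast at this
      exact this
    have h2 : (m : ℝ) ≤ σ ^ k := by
      refine le_of_forall_pow_le_mul_pow (C := σ ^ (d * r)) (by positivity) fun j => ?_
      obtain ⟨c, hc⟩ := hr j
      refine le_of_forall_pow_le_mul_pow (C := σ ^ (d * c)) (by positivity) fun L => ?_
      have h3 : m ^ (j * L) ≤ sub (d * c + (d * r * L + k * (j * L))) := (hsub _ _).2 (by
        rw [pow_add, pow_add, pow_mul a (d * r), pow_mul a k]; push_cast
        exact h.trans (hc L)
          (h.mul_le (hcast c) (h.mul_le (h.pow_le (hcast r) L) (h.refl _))))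
      have h4 : (m : ℝ) ^ (j * L) ≤ sub (d * c + (d * r * L + k * (j * L))) := by
        exact_mod_cast h3
      have h5 := h4.trans (hle _)
      rw [← pow_mul]
      refine h5.trans (le_of_eq ?_)
      ring
    have h4 : (1 : ℝ) ≤ σ ^ k := one_le_pow₀ hσ1
    linarith
  refine ⟨σ, hσ, ⟨φ, hφ, le_antisymm (hlb φ hφ) key⟩, ?_⟩
  rintro _ ⟨ψ, hψ, rfl⟩
  exact hlb ψ hψ

end IsStrassenPreorder

end Strassen

/-! ### Relations between matrices over arbitrary index types -/

section Rectangular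

variable {m n p q m' n' : Type}

/-- `A = X B Yᵀ` for some nonnegative matrices `X` and `Y`. -/
def MatBelow [Fintype p] [Fintype q] (A : Matrix m n ℝ≥0) (B : Matrix p q ℝ≥0) : Prop :=
  ∃ (X : Matrix m p ℝ≥0) (Y : Matrix n q ℝ≥0), A = X * B * Yᵀ

/-- `A = X B Yᵀ` on the level of supports, for some Boolean matrices `X` and `Y`. -/
def MatSuppBelow (A : Matrix m n ℝ≥0) (B : Matrix p q ℝ≥0) : Prop :=
  ∃ (f : m → p → Prop) (g : n → q → Prop),
    ∀ i j, A i j ≠ 0 ↔ ∃ k l, f i k ∧ B k l ≠ 0 ∧ g j l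

theorem MatSuppBelow.trans {A : Matrix m n ℝ≥0} {B : Matrix p q ℝ≥0} {C : Matrix m' n' ℝ≥0}
    (h : MatSuppBelow A B) (h' : MatSuppBelow B C) : MatSuppBelow A C := by
  obtain ⟨f, g, h⟩ := h
  obtain ⟨f', g', h'⟩ := h'
  refine ⟨fun i k => ∃ k', f i k' ∧ f' k' k, fun j l => ∃ l', g j l' ∧ g' l' l, fun i j => ?_⟩
  rw [h]
  simp only [h']
  constructor
  · rintro ⟨k', l', h1, ⟨k, l, h2, h3, h4⟩, h5⟩
    exact ⟨k, l, ⟨k', h1, h2⟩, h3, l', h5, h4⟩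
  · rintro ⟨k, l, ⟨k', h1, h2⟩, h3, l', h5, h4⟩
    exact ⟨k', l', h1, ⟨k, l, h2, h3, h4⟩, h5⟩

theorem MatSuppBelow.blockSum_right {A : Matrix m n ℝ≥0} {B : Matrix p q ℝ≥0}
    (h : MatSuppBelow A B) (C : Matrix m' n' ℝ≥0) :
    MatSuppBelow (blockSum A C) (blockSum B C) := by
  obtain ⟨f, g, h⟩ := h
  refine ⟨Sum.LiftRel f Eq, Sum.LiftRel g Eq, ?_⟩
  rintro (i | i) (j | j) <;> simp [h]

theorem MatSuppBelow.kron_right {A : Matrix m n ℝ≥0} {B : Matrix p q ℝ≥0}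
    (h : MatSuppBelow A B) (C : Matrix m' n' ℝ≥0) : MatSuppBelow (A ⊗ₖ C) (B ⊗ₖ C) := by
  obtain ⟨f, g, h⟩ := h
  refine ⟨fun i k => f i.1 k.1 ∧ i.2 = k.2, fun j l => g j.1 l.1 ∧ j.2 = l.2, ?_⟩
  rintro ⟨i, i'⟩ ⟨j, j'⟩
  rw [Matrix.kronecker_apply, mul_ne_zero_iff, h]
  constructor
  · rintro ⟨⟨k, l, h1, h2, h3⟩, h4⟩
    exact ⟨(k, i'), (l, j'), ⟨h1, rfl⟩, mul_ne_zero h2 h4, h3, rfl⟩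
  · rintro ⟨⟨k, k'⟩, ⟨l, l'⟩, ⟨h1, rfl⟩, h2, h3, rfl⟩
    exact ⟨⟨k, l, h1, left_ne_zero_of_mul h2, h3⟩, right_ne_zero_of_mul h2⟩

variable [Fintype p] [Fintype q] [Fintype m'] [Fintype n']

theorem MatBelow.trans {A : Matrix m n ℝ≥0} {B : Matrix p q ℝ≥0} {C : Matrix m' n' ℝ≥0}
    (h : MatBelow A B) (h' : MatBelow B C) : MatBelow A C := by
  obtain ⟨X, Y, rfl⟩ := h
  obtain ⟨U, V, rfl⟩ := h'
  exact ⟨X * U, Y * V, by simp only [Matrix.mul_assoc, Matrix.transpose_mul]⟩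

theorem MatBelow.blockSum_right [DecidableEq m'] [DecidableEq n'] {A : Matrix m n ℝ≥0}
    {B : Matrix p q ℝ≥0} (h : MatBelow A B) (C : Matrix m' n' ℝ≥0) :
    MatBelow (blockSum A C) (blockSum B C) := by
  obtain ⟨X, Y, rfl⟩ := h
  exact ⟨blockSum X 1, blockSum Y 1, by
    simp [blockSum, Matrix.fromBlocks_multiply, Matrix.fromBlocks_transpose]⟩

theorem MatBelow.kron_right [DecidableEq m'] [DecidableEq n'] {A : Matrix m n ℝ≥0}
    {B : Matrix p q ℝ≥0} (h : MatBelow A B) (C : Matrix m' n' ℝ≥0) :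
    MatBelow (A ⊗ₖ C) (B ⊗ₖ C) := by
  obtain ⟨X, Y, rfl⟩ := h
  refine ⟨X ⊗ₖ 1, Y ⊗ₖ 1, ?_⟩
  rw [← Matrix.kroneckerMap_transpose, ← Matrix.mul_kronecker_mul, ← Matrix.mul_kronecker_mul]
  simp

/-- A sum of nonnegative terms vanishes only if every term does, so taking supports commutes with
matrix products. -/
theorem MatBelow.suppBelow {A : Matrix m n ℝ≥0} {B : Matrix p q ℝ≥0} (h : MatBelow A B) :
    MatSuppBelow A B := by
  obtain ⟨X, Y, rfl⟩ := h
  refine ⟨fun i k => X i k ≠ 0, fun j l => Y j l ≠ 0, fun i j => ?_⟩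
  simp only [Matrix.mul_apply, Matrix.transpose_apply, ne_eq, Finset.sum_eq_zero_iff,
    Finset.mem_univ, true_imp_iff, mul_eq_zero, not_forall, not_or]
  constructor
  · rintro ⟨l, ⟨k, h1, h2⟩, h3⟩
    exact ⟨k, l, h1, h2, h3⟩
  · rintro ⟨k, l, h1, h2, h3⟩
    exact ⟨l, ⟨k, h1, h2⟩, h3⟩

theorem RIso.matBelow [Fintype m] [Fintype n] [DecidableEq m] [DecidableEq n] [DecidableEq p]
    [DecidableEq q] {A : Matrix m n ℝ≥0} {B : Matrix p q ℝ≥0} (h : RIso A B) : MatBelow A B := by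
  obtain ⟨X, -, Y, -, -, -, -, -, h⟩ := h
  exact ⟨X, Y, h⟩

theorem MatBelow.card_le {r s : ℕ} (h : MatBelow (1 : Matrix (Fin r) (Fin r) ℝ≥0)
    (1 : Matrix (Fin s) (Fin s) ℝ≥0)) : r ≤ s := by
  obtain ⟨X, Y, h⟩ := h
  rw [Matrix.mul_one] at h
  have h2 : (1 : Matrix (Fin r) (Fin r) ℝ) =
      X.map NNReal.toRealHom * Yᵀ.map NNReal.toRealHom := by
    rw [← Matrix.map_mul, ← h]
    exact (Matrix.map_one _ (map_zero _) (map_one _)).symm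
  calc r = (1 : Matrix (Fin r) (Fin r) ℝ).rank := by simp
    _ ≤ (X.map NNReal.toRealHom).rank := by rw [h2]; exact Matrix.rank_mul_le_left _ _
    _ ≤ s := Matrix.rank_le_width _

/-- An induced matching in the support of `A` bounds the identity matrix by `A`. -/
theorem MatSuppBelow.matBelow_of_one [DecidableEq m] [DecidableEq p] [DecidableEq q]
    {A : Matrix p q ℝ≥0} (h : MatSuppBelow (1 : Matrix m m ℝ≥0) A) :
    MatBelow (1 : Matrix m m ℝ≥0) A := by
  obtain ⟨f, g, h⟩ := h
  have hdiag : ∀ i, ∃ k l, f i k ∧ A k l ≠ 0 ∧ g i l := fun i => (h i i).1 (by simp)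
  choose s t hf hst hg using hdiag
  -- `X` selects row `s i` and rescales it, `Y` selects column `t j`. An entry `A (s i) (t j)` with
  -- `i ≠ j` vanishes, since otherwise it would give a nonzero off-diagonal entry of the identity.
  refine ⟨Matrix.of fun i k => if k = s i then (A (s i) (t i))⁻¹ else 0,
    Matrix.of fun j l => if l = t j then 1 else 0, Matrix.ext fun i j => ?_⟩
  simp only [Matrix.mul_apply, Matrix.transpose_apply, Matrix.of_apply, ite_mul, zero_mul,
    Finset.sum_ite_eq', Finset.mem_univ, if_true, mul_ite, mul_one, mul_zero]
  rcases eq_or_ne i j with rfl | hij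
  · rw [Matrix.one_apply_eq, inv_mul_cancel₀ (hst i)]
  · have h0 : A (s i) (t j) = 0 := by
      by_contra hne
      exact (h i j).2 ⟨s i, t j, hf i, hne, hg j⟩ (Matrix.one_apply_ne hij)
    rw [Matrix.one_apply_ne hij, h0, mul_zero]

theorem matBelow_one_of_ne_zero [DecidableEq p] [DecidableEq q] {A : Matrix p q ℝ≥0}
    (hA : A ≠ 0) : MatBelow (1 : Matrix (Fin 1) (Fin 1) ℝ≥0) A := by
  obtain ⟨i, j, hij⟩ : ∃ i j, A i j ≠ 0 := by
    by_contra! h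
    exact hA (Matrix.ext h)
  refine MatSuppBelow.matBelow_of_one ⟨fun _ k => k = i, fun _ l => l = j, fun a b => ?_⟩
  rw [Subsingleton.elim a b, Matrix.one_apply_eq]
  simpa using hij

/-- Either the support of `A` is a combinatorial rectangle, or the support of `A ⊗ A` contains an
induced matching of size two. -/
theorem matSuppBelow_one_or_two_kron (A : Matrix m n ℝ≥0) :
    MatSuppBelow A (1 : Matrix (Fin 1) (Fin 1) ℝ≥0) ∨
      MatSuppBelow (1 : Matrix (Fin 2) (Fin 2) ℝ≥0) (A ⊗ₖ A) := by
  by_cases hrect : ∀ i j i' j', A i j' ≠ 0 → A i' j ≠ 0 → A i j ≠ 0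
  · refine Or.inl ⟨fun i _ => ∃ j', A i j' ≠ 0, fun j _ => ∃ i', A i' j ≠ 0,
      fun i j => ⟨fun hij => ⟨0, 0, ⟨j, hij⟩, by simp, i, hij⟩, ?_⟩⟩
    rintro ⟨-, -, ⟨j', h1⟩, -, i', h2⟩
    exact hrect i j i' j' h1 h2
  · push Not at hrect
    obtain ⟨i, j, i', j', h1, h2, h0⟩ := hrect
    -- With `A i j' ≠ 0`, `A i' j ≠ 0` and `A i j = 0`, both diagonal entries of the chosen
    -- submatrix are `A i j' * A i' j` up to order, and both off-diagonal entries contain the factor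
    -- `A i j`.
    refine Or.inr ⟨fun s k => k = (![(i, i'), (i', i)] : Fin 2 → _) s,
      fun t l => l = (![(j', j), (j, j')] : Fin 2 → _) t, fun s t => ?_⟩
    fin_cases s <;> fin_cases t <;> simp [h0, h1, h2]

end Rectangular

/-! ### The preorders on nonnegative matrices -/

namespace NNMat

theorem below_idMat_iff (A : NNMat) (r : ℕ) : Below A (idMat r) ↔
    ∃ (B : Matrix (Fin A.rows) (Fin r) ℝ≥0) (C : Matrix (Fin r) (Fin A.cols) ℝ≥0),
      A.mat = B * C := by
  change (∃ (X : Matrix _ (Fin r) ℝ≥0) (Y : Matrix _ (Fin r) ℝ≥0),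
    A.mat = X * (1 : Matrix (Fin r) (Fin r) ℝ≥0) * Yᵀ) ↔ _
  simp only [Matrix.mul_one]
  constructor
  · rintro ⟨X, Y, h⟩
    exact ⟨X, Yᵀ, h⟩
  · rintro ⟨B, C, h⟩
    exact ⟨B, Cᵀ, by rw [Matrix.transpose_transpose, h]⟩

theorem Below.directSum_right {A B : NNMat} (h : Below A B) (C : NNMat) :
    Below (directSum A C) (directSum B C) :=
  (directSum_riso A C).matBelow.trans
    ((MatBelow.blockSum_right h C.mat).trans (directSum_riso B C).symm.matBelow)

theorem Below.kron_right {A B : NNMat} (h : Below A B) (C : NNMat) :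
    Below (kron A C) (kron B C) :=
  (kron_riso A C).matBelow.trans
    ((MatBelow.kron_right h C.mat).trans (kron_riso B C).symm.matBelow)

/-- `MatSuppBelow` for matrices of some size. -/
def SuppBelow (A B : NNMat) : Prop :=
  MatSuppBelow A.mat B.mat

theorem Below.suppBelow {A B : NNMat} (h : Below A B) : SuppBelow A B :=
  MatBelow.suppBelow h

theorem SuppBelow.trans {A B C : NNMat} (h : SuppBelow A B) (h' : SuppBelow B C) :
    SuppBelow A C :=
  MatSuppBelow.trans h h'

theorem SuppBelow.directSum_right {A B : NNMat} (h : SuppBelow A B) (C : NNMat) :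
    SuppBelow (directSum A C) (directSum B C) :=
  (directSum_riso A C).matBelow.suppBelow.trans
    ((MatSuppBelow.blockSum_right h C.mat).trans (directSum_riso B C).symm.matBelow.suppBelow)

theorem SuppBelow.kron_right {A B : NNMat} (h : SuppBelow A B) (C : NNMat) :
    SuppBelow (kron A C) (kron B C) :=
  (kron_riso A C).matBelow.suppBelow.trans
    ((MatSuppBelow.kron_right h C.mat).trans (kron_riso B C).symm.matBelow.suppBelow)

theorem suppBelow_one_or_two_kron (A : NNMat) :
    SuppBelow A (idMat 1) ∨ SuppBelow (idMat 2) (kron A A) :=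
  (matSuppBelow_one_or_two_kron A.mat).imp id fun h =>
    MatSuppBelow.trans h (kron_riso A A).symm.matBelow.suppBelow

end NNMat

/-! ### The two Strassen preorders on the semiring of classes. -/

namespace NNMatClass

open NNMat

theorem mk_idMat (n : ℕ) : mk (idMat n) = n := by
  induction n with
  | zero =>
    rw [Nat.cast_zero, zero_def]
    exact mk_eq_of_rsim (A := idMat 0) (B := zeroMat 0 0)
      (RIso.of_equiv (Equiv.refl _) (Equiv.refl _) fun i => i.elim0).rsim
  | succ n ih =>
    rw [Nat.cast_succ, ← ih, one_def, mk_add]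
    have h : RIso (directSum (idMat n) (idMat 1)).mat (idMat (n + 1)).mat := by
      refine (directSum_riso _ _).trans (RIso.of_equiv finSumFinEquiv finSumFinEquiv ?_)
      intro (i : Fin n ⊕ Fin 1) (j : Fin n ⊕ Fin 1)
      change blockSum (1 : Matrix (Fin n) (Fin n) ℝ≥0) (1 : Matrix (Fin 1) (Fin 1) ℝ≥0) i j =
        (1 : Matrix (Fin (n + 1)) (Fin (n + 1)) ℝ≥0) (finSumFinEquiv i) (finSumFinEquiv j)
      rw [blockSum, Matrix.fromBlocks_one, Matrix.one_apply, Matrix.one_apply]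
      simp only [EmbeddingLike.apply_eq_iff_eq]
    exact (mk_eq_of_rsim h.rsim).symm

theorem mk_kronPow (A : NNMat) (k : ℕ) : mk (kronPow A k) = mk A ^ k := by
  induction k with
  | zero => rw [pow_zero]; rfl
  | succ k ih => rw [pow_succ, ← ih, mk_mul]; rfl

theorem mk_eq_zero {A : NNMat} (hA : A.mat = 0) : mk A = 0 :=
  mk_eq_of_rsim (by rw [hA]; exact RSim.zero)

theorem isStrassenPreorder_le : IsStrassenPreorder (fun x y : NNMatClass => x ≤ y) where
  refl := le_refl
  trans := le_trans
  add_right {x y} h z := by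
    induction x using ind with | h A
    induction y using ind with | h B
    induction z using ind with | h C
    exact Below.directSum_right h C
  mul_right {x y} h z := by
    induction x using ind with | h A
    induction y using ind with | h B
    induction z using ind with | h C
    exact Below.kron_right h C
  le_of_cast {n m} h := by
    rw [← mk_idMat, ← mk_idMat] at h
    exact MatBelow.card_le h
  zero_le x := by
    induction x using ind with | h A
    exact ⟨0, 0, Matrix.ext fun i => i.elim0⟩
  bounded x := by
    induction x using ind with | h A
    exact ⟨A.rows, by
      rw [← mk_idMat]
      exact (below_idMat_iff _ _).2 ⟨1, A.mat, by simp⟩⟩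
  one_le x hx := by
    induction x using ind with | h A
    exact matBelow_one_of_ne_zero fun hA => hx (mk_eq_zero hA)

/-- The preorder `SuppBelow` on the classes of nonnegative matrices. -/
def SuppLE : NNMatClass → NNMatClass → Prop :=
  Quotient.lift₂ SuppBelow fun _ _ _ _ h h' => propext
    ⟨fun k => ((Sim.below (Setoid.symm h)).suppBelow.trans k).trans (Sim.below h').suppBelow,
      fun k => ((Sim.below h).suppBelow.trans k).trans (Sim.below (Setoid.symm h')).suppBelow⟩

theorem suppLE_of_le {x y : NNMatClass} (h : x ≤ y) : SuppLE x y := by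
  induction x using ind with | h A
  induction y using ind with | h B
  exact Below.suppBelow h

/-- Forgetting the values of the entries does not change which integers lie below `x`. This
transfers both the axiom `le_of_cast` and the subrank between the two preorders. -/
theorem natCast_le_of_suppLE {n : ℕ} {x : NNMatClass} (h : SuppLE n x) :
    (n : NNMatClass) ≤ x := by
  induction x using ind with | h A
  rw [← mk_idMat] at h ⊢
  exact MatSuppBelow.matBelow_of_one h

theorem isStrassenPreorder_suppLE : IsStrassenPreorder SuppLE where
  refl x := suppLE_of_le le_rfl
  trans {x y z} h h' := by
    induction x using ind with | h A
    induction y using ind with | h B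
    induction z using ind with | h C
    exact SuppBelow.trans h h'
  add_right {x y} h z := by
    induction x using ind with | h A
    induction y using ind with | h B
    induction z using ind with | h C
    exact SuppBelow.directSum_right h C
  mul_right {x y} h z := by
    induction x using ind with | h A
    induction y using ind with | h B
    induction z using ind with | h C
    exact SuppBelow.kron_right h C
  le_of_cast h := isStrassenPreorder_le.le_of_cast (natCast_le_of_suppLE h)
  zero_le x := suppLE_of_le (isStrassenPreorder_le.zero_le x)
  bounded x := (isStrassenPreorder_le.bounded x).imp fun _ => suppLE_of_le
  one_le x hx := suppLE_of_le (isStrassenPreorder_le.one_le x hx)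

theorem suppLE_one_or_two_suppLE_sq (x : NNMatClass) : SuppLE x 1 ∨ SuppLE 2 (x ^ 2) := by
  induction x using ind with | h A
  rw [sq, mk_mul, ← Nat.cast_two, ← mk_idMat, one_def]
  exact suppBelow_one_or_two_kron A

/-! ### Rank and subrank as comparisons with integers, and the conclusion. -/

theorem nonnegRank_le_iff (A : NNMat) (n : ℕ) : A.nonnegRank ≤ n ↔ mk A ≤ n := by
  rw [← mk_idMat, mk_le_mk]
  constructor
  · intro h
    have h1 : Below A (idMat A.nonnegRank) :=
      (below_idMat_iff _ _).2 (Nat.sInf_mem (nonnegRank_set_nonempty A))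
    have h2 : Below (idMat A.nonnegRank) (idMat n) := by
      rw [← mk_le_mk, mk_idMat, mk_idMat]
      exact isStrassenPreorder_le.cast_le h
    exact below_trans h1 h2
  · intro h
    exact Nat.sInf_le ((below_idMat_iff _ _).1 h)

theorem le_nonnegSubrank_iff (A : NNMat) (n : ℕ) :
    n ≤ A.nonnegSubrank ↔ (n : NNMatClass) ≤ mk A := by
  obtain ⟨hne, hb⟩ := nonnegSubrank_set_bdd A
  rw [← mk_idMat, mk_le_mk]
  constructor
  · intro h
    have h1 : Below (idMat A.nonnegSubrank) A := Nat.sSup_mem hne hb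
    have h2 : Below (idMat n) (idMat A.nonnegSubrank) := by
      rw [← mk_le_mk, mk_idMat, mk_idMat]
      exact isStrassenPreorder_le.cast_le h
    exact below_trans h2 h1
  · intro h
    exact le_csSup hb h

/-- The zero class escapes the general argument, which needs `1 ≤ a`. The exponent `k = 0` is
excluded because the zeroth power is `I_1`. -/
theorem asymptotics_of_mk_eq_zero {A : NNMat} (hA : mk A = 0) {u : ℕ → ℕ}
    (hu : ∀ k ≠ 0, u k = 0) :
    Filter.Tendsto (fun k : ℕ => (u k : ℝ) ^ (1 / (k : ℝ))) Filter.atTop (𝓝 0) ∧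
      {x : ℝ | ∃ φ ∈ asympSpectrum NNMatClass, x = φ (mk A)} = {0} := by
  refine ⟨tendsto_const_nhds.congr' ?_, ?_⟩
  · filter_upwards [Filter.eventually_ne_atTop 0] with k hk
    rw [hu k hk, Nat.cast_zero, Real.zero_rpow (by positivity)]
  · obtain ⟨φ, hφ⟩ := isStrassenPreorder_le.spectrumOf_nonempty
    ext x
    simp only [hA, map_zero, NNReal.coe_zero, Set.mem_ofPred_eq, Set.mem_singleton_iff]
    exact ⟨fun ⟨_, _, hx⟩ => hx, fun hx => ⟨φ, hφ, hx⟩⟩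

theorem asympNonnegRank_spec (A : NNMat) :
    Filter.Tendsto (fun k : ℕ => ((A.kronPow k).nonnegRank : ℝ) ^ (1 / (k : ℝ)))
        Filter.atTop (𝓝 A.asympNonnegRank) ∧
      IsGreatest {x : ℝ | ∃ φ ∈ asympSpectrum NNMatClass, x = φ (mk A)} A.asympNonnegRank := by
  suffices ∃ ρ : ℝ, Filter.Tendsto (fun k : ℕ => ((A.kronPow k).nonnegRank : ℝ) ^ (1 / (k : ℝ)))
      Filter.atTop (𝓝 ρ) ∧
      IsGreatest {x : ℝ | ∃ φ ∈ asympSpectrum NNMatClass, x = φ (mk A)} ρ by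
    obtain ⟨ρ, h1, h2⟩ := this
    have e : A.asympNonnegRank = ρ := h1.limUnder_eq
    rw [e]
    exact ⟨h1, h2⟩
  by_cases hA : mk A = 0
  · obtain ⟨h1, h2⟩ := asymptotics_of_mk_eq_zero hA (u := fun k => (A.kronPow k).nonnegRank)
      fun k hk => Nat.le_zero.1 ((nonnegRank_le_iff _ _).2 (by
        rw [mk_kronPow, hA, zero_pow hk, Nat.cast_zero]))
    exact ⟨0, h1, by rw [h2]; exact isGreatest_singleton⟩
  · exact isStrassenPreorder_le.tendsto_rank hA fun k n => by
      rw [nonnegRank_le_iff, mk_kronPow]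

theorem asympNonnegSubrank_spec (A : NNMat) :
    Filter.Tendsto (fun k : ℕ => ((A.kronPow k).nonnegSubrank : ℝ) ^ (1 / (k : ℝ)))
        Filter.atTop (𝓝 A.asympNonnegSubrank) ∧
      IsLeast {x : ℝ | ∃ φ ∈ asympSpectrum NNMatClass, x = φ (mk A)} A.asympNonnegSubrank := by
  suffices ∃ σ : ℝ, Filter.Tendsto
      (fun k : ℕ => ((A.kronPow k).nonnegSubrank : ℝ) ^ (1 / (k : ℝ))) Filter.atTop (𝓝 σ) ∧
      IsLeast {x : ℝ | ∃ φ ∈ asympSpectrum NNMatClass, x = φ (mk A)} σ by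
    obtain ⟨σ, h1, h2⟩ := this
    have e : A.asympNonnegSubrank = σ := h1.limUnder_eq
    rw [e]
    exact ⟨h1, h2⟩
  by_cases hA : mk A = 0
  · obtain ⟨h1, h2⟩ := asymptotics_of_mk_eq_zero hA (u := fun k => (A.kronPow k).nonnegSubrank)
      fun k hk => Nat.le_zero.1 (isStrassenPreorder_le.le_of_cast (by
        have := (le_nonnegSubrank_iff (A.kronPow k) _).1 le_rfl
        rwa [mk_kronPow, hA, zero_pow hk, ← Nat.cast_zero] at this))
    exact ⟨0, h1, by rw [h2]; exact isLeast_singleton⟩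
  · have hsub : ∀ k n : ℕ, n ≤ (A.kronPow k).nonnegSubrank ↔ (n : NNMatClass) ≤ mk A ^ k :=
      fun k n => by rw [le_nonnegSubrank_iff, mk_kronPow]
    -- Minimality over the smaller spectrum of `SuppLE` is discarded. That `σ` bounds every monotone
    -- point from below is proved again, directly from the limit.
    obtain ⟨σ, h1, ⟨φ, hφ, hφσ⟩, -⟩ := isStrassenPreorder_suppLE.tendsto_subrank hA
      (sub := fun k => (A.kronPow k).nonnegSubrank)
      (fun k n => (hsub k n).trans ⟨suppLE_of_le, natCast_le_of_suppLE⟩)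
      ((suppLE_one_or_two_suppLE_sq (mk A)).imp id fun h => ⟨2, h⟩)
    refine ⟨σ, h1, ⟨φ, fun a b hab => hφ a b (suppLE_of_le hab), hφσ⟩, ?_⟩
    rintro _ ⟨ψ, hψ, rfl⟩
    exact IsStrassenPreorder.le_apply_of_tendsto hψ (fun k => (hsub k _).1 le_rfl) h1

end NNMatClass

end NonnegMatrix

theorem mainTheorem1 (A : NonnegMatrix.NNMat) :
    (Filter.Tendsto (fun k : ℕ => ((A.kronPow k).nonnegRank : ℝ) ^ (1 / (k : ℝ)))
        Filter.atTop (𝓝 A.asympNonnegRank) ∧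
      IsGreatest {x : ℝ | ∃ φ ∈ NonnegMatrix.asympSpectrum NonnegMatrix.NNMatClass,
        x = φ (NonnegMatrix.NNMatClass.mk A)} A.asympNonnegRank) ∧
    (Filter.Tendsto (fun k : ℕ => ((A.kronPow k).nonnegSubrank : ℝ) ^ (1 / (k : ℝ)))
        Filter.atTop (𝓝 A.asympNonnegSubrank) ∧
      IsLeast {x : ℝ | ∃ φ ∈ NonnegMatrix.asympSpectrum NonnegMatrix.NNMatClass,
        x = φ (NonnegMatrix.NNMatClass.mk A)} A.asympNonnegSubrank) := by
  exact ⟨NonnegMatrix.NNMatClass.asympNonnegRank_spec A,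
    NonnegMatrix.NNMatClass.asympNonnegSubrank_spec A⟩
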